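/- Let $q$ be a power of an odd prime $p$, let $\ell\neq p$ be a prime and let $\psi:\mathbb F_q\to\overline{\mathbb Q}_\ell^{\times}$ be a non-trivial additive character. Let $V=\mathbb F_q^4$ with its standard symplectic form, and let $E=\mathbb F_{q^2}$, regarded as a two-dimensional $\mathbb F_q$-space with the symmetric bilinear form $\langle x,y\rangle_E=\frac12(xy^q+x^qy)$; let $O(E)$ be its orthogonal group, $SO(E)\subset O(E)$ the subgroup of elements of determinant $1$, and $\sigma\in O(E)$ the map $x\mapsto x^q$. Give $V\otimes E$ the symplectic form that is the tensor product of the two forms, let $V=L\oplus L'$ be the standard decomposition into Lagrangian subspaces, and let $W$ be the Weil representation of $Sp(V\otimes E)$ attached to $\psi$, on the space of $\overline{\mathbb Q}_\ell$-valued functions on $L'\otimes E$. Write $\eta$ for its character. The map $(g,t)\mapsto g\otimes t$ makes $Sp(V)\times O(E)$ act on $W$. Let $W_1^-$ be the representation of $Sp(V)=Sp(4,\mathbb F_q)$ on the space of those $f\in W$ that satisfy $(1\otimes t)f=f$ for all $t\in SO(E)$ and $(1\otimes\sigma)f=-f$, and let $\theta_{10}$ be its character. Let $F$ be the Frobenius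 endomorphism (raising matrix entries to the $q$-th power) of the algebraic group $Sp(4)$ over $\overline{\mathbb F}_q$, and let $T\subset Sp(4)$ be an $F$-stable maximal torus such that $T^F$ has order $q^2+1$. Let $s\in T^F$ with $s\neq\pm1$. Then $s$ is regular semisimple (it is semisimple, and the identity component of its centralizer in $Sp(4)$ is a maximal torus), and $\theta_{10}(s)=1$. Moreover, for $t\in O(E)$, $$\eta(s\otimes t)=\begin{cases}1 & \text{if } t\in SO(E),\\ -1 & \text{if } t\in O(E)\setminus SO(E).\end{cases}$$ -/

import Mathlib

open scoped TensorProduct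

set_option linter.unusedSectionVars false

namespace Theta10

section Weil

variable {F : Type*} [Field F] {U : Type*} [AddCommGroup U] [Module F U]

/-- The group of linear automorphisms preserving a bilinear form. -/
def isometryGroup (B : LinearMap.BilinForm F U) : Subgroup (U ≃ₗ[F] U) where
  carrier := {g | ∀ x y, B (g x) (g y) = B x y}
  one_mem' := by intro x y; rfl
  mul_mem' := by
    intro a b ha hb x y
    rw [LinearEquiv.mul_apply, LinearEquiv.mul_apply, ha, hb]
  inv_mem' := by
    intro a ha x y
    have := ha (a⁻¹ x) (a⁻¹ y)
    rw [← LinearEquiv.mul_apply, ← LinearEquiv.mul_apply, mul_inv_cancel] at this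
    exact this.symm

/-- `(U, B)` is a symplectic space and `M`, `M'` are complementary Lagrangian subspaces. -/
structure IsPolarization (B : LinearMap.BilinForm F U) (M M' : Submodule F U) : Prop where
  alt : ∀ x, B x x = 0
  nondeg : ∀ x, (∀ y, B x y = 0) → x = 0
  isotropic_left : ∀ x ∈ M, ∀ y ∈ M, B x y = 0
  isotropic_right : ∀ x ∈ M', ∀ y ∈ M', B x y = 0
  isCompl : IsCompl M M'

variable {B : LinearMap.BilinForm F U} {M M' : Submodule F U} {k : Type*} [Field k]

/-- The Schrödinger representation with central character `ψ` of the Heisenberg group `U × F`,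
`(u, a) (v, b) = (u + v, a + b + B u v / 2)`, on functions on `M'`. This is the operator of `(u, 0)`;
the element `(u, a)` acts by `ψ a` times it. For `u = m + m'` with `m` in `M` and `m'` in `M'`,
it sends `f` to the function `x ↦ ψ (B m x - B m m' / 2) * f (x - m')`. -/
noncomputable def heisenbergOp (h : IsPolarization B M M') (ψ : AddChar F k) (u : U) :
    Module.End k (M' → k) where
  toFun f x :=
    ψ (B (M.projection M' h.isCompl u) x
        - 2⁻¹ * B (M.projection M' h.isCompl u) (M'.projection M h.isCompl.symm u))
      * f (x - M'.projectionOnto M h.isCompl.symm u)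
  map_add' f g := by ext x; simp [mul_add]
  map_smul' c f := by ext x; simp [mul_left_comm]

/-- `ω` is a Weil representation of `Sp (U, B)` attached to `ψ`: the operators `ω g` implement the
action of the isometry group by automorphisms `(u, a) ↦ (g u, a)` of the Heisenberg group. -/
def IsWeilRep (h : IsPolarization B M M') (ψ : AddChar F k)
    (ω : Representation k (isometryGroup B) (M' → k)) : Prop :=
  ∀ (g : isometryGroup B) (u : U),
    ω g * heisenbergOp h ψ u = heisenbergOp h ψ ((g : U ≃ₗ[F] U) u) * ω g

theorem heis_apply (h : IsPolarization B M M') (ψ : AddChar F k) (m : M) (m' : M') (f : M' → k)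
    (x : M') : heisenbergOp h ψ (m + m') f x = ψ (B m x - 2⁻¹ * B m m') * f (x - m') := by
  simp [heisenbergOp, Submodule.projection_apply]

theorem exists_decomp (h : IsPolarization B M M') (u : U) : ∃ (m : M) (m' : M'), u = m + m' := by
  obtain ⟨x, hx, y, hy, e⟩ := Submodule.mem_sup.1 (h.isCompl.sup_eq_top ▸ Submodule.mem_top : u ∈ M ⊔ M')
  exact ⟨⟨x, hx⟩, ⟨y, hy⟩, e.symm⟩

theorem skew (h : IsPolarization B M M') (x y : U) : B x y = - B y x := by
  have h1 := h.alt (x + y)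
  simp only [map_add, LinearMap.add_apply, h.alt] at h1
  linear_combination h1

theorem heis_mul (h : IsPolarization B M M') (h2 : (2 : F) ≠ 0) (ψ : AddChar F k) (u v : U) :
    heisenbergOp h ψ u * heisenbergOp h ψ v = ψ (2⁻¹ * B u v) • heisenbergOp h ψ (u + v) := by
  obtain ⟨m, m', rfl⟩ := exists_decomp h u
  obtain ⟨n, n', rfl⟩ := exists_decomp h v
  have e : (m + m' + (n + n') : U) = ((m + n : M) : U) + ((m' + n' : M') : U) := by
    push_cast; abel
  ext1 f; ext x
  rw [Module.End.mul_apply, LinearMap.smul_apply, Pi.smul_apply, e, heis_apply, heis_apply,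
    heis_apply, smul_eq_mul, ← mul_assoc, ← mul_assoc, ← AddChar.map_add_eq_mul,
    ← AddChar.map_add_eq_mul, sub_sub]
  congr 2
  have h1 := h.isotropic_left m m.2 n n.2
  have h3 := h.isotropic_right m' m'.2 n' n'.2
  have h4 := skew h m' n
  simp only [map_add, LinearMap.add_apply, Submodule.coe_add, Submodule.coe_sub, map_sub, h1, h3, h4]
  field_simp
  ring

theorem heis_zero (h : IsPolarization B M M') (ψ : AddChar F k) : heisenbergOp h ψ 0 = 1 := by
  ext1 f; ext x
  have := heis_apply h ψ 0 0 f x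
  simpa using this

section sums
variable [Finite U]

theorem sum_char_eq_zero {A : Type*} [AddCommGroup A] [Module F A] [Fintype A] (φ : A →ₗ[F] F)
    (hφ : φ ≠ 0) {ψ : AddChar F k} (hψ : ψ ≠ 1) : ∑ x, ψ (φ x) = 0 := by
  have := AddChar.sum_eq_zero_of_ne_one (ψ := ψ.compAddMonoidHom φ.toAddMonoidHom) ?_
  · simpa using this
  · obtain ⟨a, ha⟩ := AddChar.ne_one_iff.1 hψ
    obtain ⟨x, hx⟩ := LinearMap.surjective hφ a
    refine AddChar.ne_one_iff.2 ⟨x, ?_⟩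
    simpa [hx] using ha

theorem pair_left_ne (h : IsPolarization B M M') (m : M) (hm : m ≠ 0) :
    (B m).comp M'.subtype ≠ 0 := by
  intro h0
  apply hm
  ext
  refine h.nondeg _ fun y => ?_
  obtain ⟨n, n', rfl⟩ := exists_decomp h y
  have := LinearMap.congr_fun h0 n'
  simp at this
  simp [this, h.isotropic_left m m.2 n n.2]

theorem pair_right_ne (h : IsPolarization B M M') (x : M') (hx : x ≠ 0) :
    (B.flip x).comp M.subtype ≠ 0 := by
  intro h0
  apply hx
  ext
  refine h.nondeg _ fun y => ?_
  obtain ⟨n, n', rfl⟩ := exists_decomp h y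
  have := LinearMap.congr_fun h0 n
  simp at this
  simp [skew h x n, this, h.isotropic_right x x.2 n' n'.2]

theorem trace_heis (h : IsPolarization B M M') {ψ : AddChar F k} (hψ : ψ ≠ 1) (u : U) (hu : u ≠ 0) :
    LinearMap.trace k _ (heisenbergOp h ψ u) = 0 := by
  classical
  have := Fintype.ofFinite M'
  obtain ⟨m, m', rfl⟩ := exists_decomp h u
  rw [LinearMap.trace_eq_matrix_trace k (Pi.basisFun k M'), Matrix.trace]
  simp only [Matrix.diag_apply, LinearMap.toMatrix_apply, Pi.basisFun_apply, Pi.basisFun_repr,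
    heis_apply]
  by_cases hm' : m' = 0
  · subst hm'
    have hm : m ≠ 0 := by rintro rfl; simp at hu
    simpa using sum_char_eq_zero _ (pair_left_ne h m hm) hψ
  · refine Finset.sum_eq_zero fun x _ => ?_
    rw [Pi.single_eq_of_ne, mul_zero]
    simpa using hm'

variable (h : IsPolarization B M M') (ψ : AddChar F k)

theorem diag_proj [Fintype M] [DecidableEq M'] (hψ : ψ ≠ 1) (y : M') (f : M' → k) :
    (∑ m : M, ψ (- B m y) • heisenbergOp h ψ (m : U)) f
      = ((Fintype.card M : k) * f y) • Pi.single y 1 := by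
  ext x
  have key : ∀ m : M, heisenbergOp h ψ (m : U) f x = ψ (B m x) * f x := fun m => by
    have := heis_apply h ψ m 0 f x
    simpa using this
  simp only [LinearMap.sum_apply, Finset.sum_apply, LinearMap.smul_apply, Pi.smul_apply, key,
    smul_eq_mul, ← mul_assoc, ← AddChar.map_add_eq_mul]
  rw [← Finset.sum_mul]
  by_cases hxy : x = y
  · subst hxy; simp
  · rw [Pi.single_eq_of_ne hxy, mul_zero]
    have := sum_char_eq_zero _ (pair_right_ne h (x - y) (sub_ne_zero.2 hxy)) hψ
    simp at this
    simp [neg_add_eq_sub, this]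

theorem heis_single [DecidableEq M'] (y z : M') :
    heisenbergOp h ψ ((z - y : M') : U) (Pi.single y 1) = Pi.single z 1 := by
  ext x
  have := heis_apply h ψ 0 (z - y) (Pi.single y 1) x
  simp only [ZeroMemClass.coe_zero, zero_add] at this
  rw [this]
  simp only [map_zero, LinearMap.zero_apply, mul_zero, sub_zero, AddChar.map_zero_eq_one, one_mul]
  by_cases hx : x = z
  · subst hx; simp
  · rw [Pi.single_eq_of_ne hx, Pi.single_eq_of_ne]
    intro h'
    apply hx
    rwa [sub_eq_iff_eq_add, add_sub_cancel] at h'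

/-- operators intertwining the Schrödinger representation and its twist by `g` -/
def Twines (g : U ≃ₗ[F] U) (T : Module.End k (M' → k)) : Prop :=
  ∀ u, T * heisenbergOp h ψ u = heisenbergOp h ψ (g u) * T

variable {h ψ}

theorem Twines.mul {g g' : U ≃ₗ[F] U} {T T' : Module.End k (M' → k)} (hT : Twines h ψ g T)
    (hT' : Twines h ψ g' T') : Twines h ψ (g * g') (T * T') := fun u => by
  rw [mul_assoc, hT' u, ← mul_assoc, hT, mul_assoc]; rfl

theorem Twines.injective [CharZero k] (hψ : ψ ≠ 1) {g : U ≃ₗ[F] U} {T : Module.End k (M' → k)}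
    (hT : Twines h ψ g T) (h0 : T ≠ 0) : Function.Injective T := by
  classical
  have := Fintype.ofFinite M
  rw [← LinearMap.ker_eq_bot, LinearMap.ker_eq_bot']
  intro f hf
  by_contra hne
  obtain ⟨y, hy⟩ := Function.ne_iff.1 hne
  apply h0
  have h1 : T (Pi.single y 1) = 0 := by
    have e := congrArg T (diag_proj h ψ hψ y f)
    have e2 : T ((∑ m : M, ψ (- B m y) • heisenbergOp h ψ (m : U)) f) = 0 := by
      simp only [LinearMap.sum_apply, LinearMap.smul_apply, map_sum, map_smul]
      refine Finset.sum_eq_zero fun m _ => ?_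
      rw [← Module.End.mul_apply, hT, Module.End.mul_apply, hf, map_zero, smul_zero]
    rw [e2, map_smul, eq_comm, smul_eq_zero] at e
    refine e.resolve_left ?_
    simpa using hy
  refine LinearMap.pi_ext' fun z => ?_
  ext1
  simp only [LinearMap.comp_apply, LinearMap.single_apply, LinearMap.zero_apply]
  rw [← heis_single h ψ y z, ← Module.End.mul_apply, hT, Module.End.mul_apply, h1, map_zero]

theorem commutant [CharZero k] (hψ : ψ ≠ 1) {T : Module.End k (M' → k)}
    (hT : ∀ u, T * heisenbergOp h ψ u = heisenbergOp h ψ u * T) : ∃ c : k, T = c • 1 := by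
  classical
  have := Fintype.ofFinite M
  have h1 : ∀ y, T (Pi.single y 1) = (T (Pi.single y 1) y) • Pi.single y 1 := fun y => by
    have e := congrArg T (diag_proj h ψ hψ y (Pi.single y 1))
    have e2 : T ((∑ m : M, ψ (- B m y) • heisenbergOp h ψ (m : U)) (Pi.single y 1))
        = (∑ m : M, ψ (- B m y) • heisenbergOp h ψ (m : U)) (T (Pi.single y 1)) := by
      simp only [LinearMap.sum_apply, LinearMap.smul_apply, map_sum, map_smul]
      refine Finset.sum_congr rfl fun m _ => ?_
      rw [← Module.End.mul_apply, hT, Module.End.mul_apply]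
    rw [e2, diag_proj h ψ hψ, map_smul, Pi.single_eq_same, mul_one, mul_smul] at e
    have hc : (Fintype.card M : k) ≠ 0 := by simp
    exact (smul_right_injective _ hc e).symm
  refine ⟨T (Pi.single 0 1) 0, ?_⟩
  refine LinearMap.pi_ext' fun z => ?_
  ext1
  simp only [LinearMap.comp_apply, LinearMap.single_apply, LinearMap.smul_apply,
    Module.End.one_apply]
  rw [← heis_single h ψ 0 z, ← Module.End.mul_apply, hT, Module.End.mul_apply, h1 0, map_smul]
  simp

theorem Twines.unique [CharZero k] (hψ : ψ ≠ 1) {g : U ≃ₗ[F] U} {T T' : Module.End k (M' → k)}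
    (hT : Twines h ψ g T) (h0 : T ≠ 0) (hT' : Twines h ψ g T') : ∃ c : k, T' = c • T := by
  have hinj := hT.injective hψ h0
  obtain ⟨S, hS⟩ := (Module.End.isUnit_iff T).2
    ⟨hinj, LinearMap.injective_iff_surjective.1 hinj⟩
  obtain ⟨c, hc⟩ := commutant (h := h) (ψ := ψ) hψ (T := ↑S⁻¹ * T') fun u => by
    rw [mul_assoc, hT', ← mul_assoc, ← mul_assoc]
    congr 1
    rw [Units.inv_mul_eq_iff_eq_mul, ← mul_assoc, hS, hT, ← hS, mul_assoc, Units.mul_inv, mul_one]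
  refine ⟨c, ?_⟩
  rw [Units.inv_mul_eq_iff_eq_mul, hS] at hc
  rw [hc]; simp

theorem exists_twines [CharZero k] (h2 : (2 : F) ≠ 0) (hψ : ψ ≠ 1) (g : isometryGroup B) :
    ∃ T, Twines h ψ g T ∧ T ≠ 0 := by
  classical
  have := Fintype.ofFinite U
  have := Fintype.ofFinite M'
  let av (A : Module.End k (M' → k)) : Module.End k (M' → k) :=
    ∑ u, heisenbergOp h ψ ((g : U ≃ₗ[F] U) u) * A * heisenbergOp h ψ (-u)
  have hav : ∀ A, Twines h ψ g (av A) := by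
    intro A v
    simp only [av, Finset.sum_mul, Finset.mul_sum]
    rw [← Equiv.sum_comp (Equiv.addLeft v)]
    refine Finset.sum_congr rfl fun w _ => ?_
    rw [Equiv.coe_addLeft, mul_assoc, heis_mul h h2, ← mul_assoc, ← mul_assoc, heis_mul h h2,
      ← map_add, g.2, smul_mul_assoc, smul_mul_assoc, mul_smul_comm]
    congr 2
    · simp [h.alt v, skew h v w]
    · congr 1
      rw [neg_add_rev, neg_add_cancel_right]
  by_contra hcon
  push Not at hcon
  have h0 : ∀ A, av A = 0 := fun A => hcon _ (hav A)
  have h1 : ∑ u, (heisenbergOp h ψ (-u) (fun _ => 1) 0) • heisenbergOp h ψ ((g : U ≃ₗ[F] U) u)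
      = 0 := by
    refine LinearMap.ext fun w => ?_
    have := LinearMap.congr_fun (h0 ((LinearMap.proj 0).smulRight w)) (fun _ => 1)
    simpa [av, -map_neg] using this
  have h3 := congrArg (LinearMap.trace k _) h1
  rw [map_sum, Finset.sum_eq_single 0, neg_zero, map_zero, heis_zero] at h3
  · simp at h3
  · intro u _ hu
    rw [map_smul, trace_heis h hψ, smul_zero]
    simpa using hu
  · simp


section parity

theorem isProj_range {W : Type*} [AddCommGroup W] [Module k W] {e : Module.End k W}
    (he : e * e = e) : LinearMap.IsProj (LinearMap.range e) e where
  map_mem x := ⟨x, rfl⟩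
  map_id := by
    rintro _ ⟨x, rfl⟩
    exact LinearMap.congr_fun he x

/-- The compression of `T` to the range of `e`. -/
noncomputable def compress {W : Type*} [AddCommGroup W] [Module k W] (e T : Module.End k W) :
    Module.End k (LinearMap.range e) :=
  e.rangeRestrict ∘ₗ T ∘ₗ (LinearMap.range e).subtype

theorem compress_mul {W : Type*} [AddCommGroup W] [Module k W] {e T S : Module.End k W}
    (he : e * e = e) (hS : Commute S e) : compress e (T * S) = compress e T * compress e S := by
  refine LinearMap.ext fun x => Subtype.ext ?_
  obtain ⟨_, y, rfl⟩ := x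
  have h1 : S (e y) = e (S (e y)) := by
    have := LinearMap.congr_fun hS.eq (e y)
    simp only [Module.End.mul_apply] at this
    rw [← this, ← Module.End.mul_apply e e, he]
  change e (T (S (e y))) = e (T (e (S (e y))))
  rw [← h1]

theorem compress_one {W : Type*} [AddCommGroup W] [Module k W] {e : Module.End k W}
    (he : e * e = e) : compress e 1 = 1 := by
  refine LinearMap.ext fun x => Subtype.ext ?_
  exact (isProj_range he).map_id _ x.2

theorem compress_smul {W : Type*} [AddCommGroup W] [Module k W] (e T : Module.End k W) (c : k) :
    compress e (c • T) = c • compress e T := by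
  ext x
  simp [compress]

variable (k M')

/-- `(P f) x = f (-x)` -/
noncomputable def parity : Module.End k (M' → k) := LinearMap.funLeft k k (fun x => -x)

/-- projection to the even functions -/
noncomputable def evenProj : Module.End k (M' → k) := (2 : k)⁻¹ • (1 + parity M' k)

/-- projection to the odd functions -/
noncomputable def oddProj : Module.End k (M' → k) := (2 : k)⁻¹ • (1 - parity M' k)

variable {k M'}

theorem parity_mul_self : parity M' k * parity M' k = 1 := by
  ext; simp [parity, LinearMap.funLeft]

theorem evenProj_idem [CharZero k] : evenProj M' k * evenProj M' k = evenProj M' k := by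
  have : (1 + parity M' k) * (1 + parity M' k) = (2 : k) • (1 + parity M' k) := by
    rw [two_smul, mul_add, add_mul, add_mul, parity_mul_self, mul_one, one_mul, mul_one]
    abel
  rw [evenProj, smul_mul_smul_comm, this, smul_smul]
  congr 1; field_simp

theorem oddProj_idem [CharZero k] : oddProj M' k * oddProj M' k = oddProj M' k := by
  have : (1 - parity M' k) * (1 - parity M' k) = (2 : k) • (1 - parity M' k) := by
    rw [two_smul, mul_sub, sub_mul, sub_mul, parity_mul_self, mul_one, one_mul, mul_one]
    abel
  rw [oddProj, smul_mul_smul_comm, this, smul_smul]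
  congr 1; field_simp

theorem trace_parity (h2 : (2 : F) ≠ 0) : LinearMap.trace k _ (parity M' k) = 1 := by
  classical
  have := Fintype.ofFinite M'
  rw [LinearMap.trace_eq_matrix_trace k (Pi.basisFun k M'), Matrix.trace]
  simp only [Matrix.diag_apply, LinearMap.toMatrix_apply, Pi.basisFun_apply, Pi.basisFun_repr,
    parity, LinearMap.funLeft_apply]
  rw [Finset.sum_eq_single 0]
  · simp
  · intro x _ hx
    rw [Pi.single_eq_of_ne]
    intro e
    apply hx
    have : (2 : F) • x = 0 := by rw [two_smul]; nth_rw 1 [← e]; simp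
    exact (smul_eq_zero.1 this).resolve_left h2
  · simp

theorem finrank_even [CharZero k] (h2 : (2 : F) ≠ 0) :
    Module.finrank k (LinearMap.range (evenProj M' k))
      = Module.finrank k (LinearMap.range (oddProj M' k)) + 1 := by
  have h1 := (isProj_range (evenProj_idem (M' := M') (k := k))).trace
  have h3 := (isProj_range (oddProj_idem (M' := M') (k := k))).trace
  have h4 : evenProj M' k = oddProj M' k + parity M' k := by
    rw [evenProj, oddProj]
    module
  have h5 := congrArg (LinearMap.trace k _) h4
  rw [map_add, h1, h3, trace_parity h2] at h5
  exact_mod_cast h5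

theorem parity_heis (h : IsPolarization B M M') (ψ : AddChar F k) (u : U) :
    parity M' k * heisenbergOp h ψ u = heisenbergOp h ψ (-u) * parity M' k := by
  obtain ⟨m, m', rfl⟩ := exists_decomp h u
  have e : (-((m : U) + m')) = ((-m : M) : U) + ((-m' : M') : U) := by push_cast; abel
  refine LinearMap.ext fun f => funext fun x => ?_
  rw [Module.End.mul_apply, Module.End.mul_apply, e, heis_apply, parity, LinearMap.funLeft_apply,
    heis_apply, LinearMap.funLeft_apply]
  congr 2
  · simp
  · abel

theorem Twines.commute_parity [CharZero k] (h2 : (2 : F) ≠ 0) (hψ : ψ ≠ 1) {g : U ≃ₗ[F] U}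
    {T : Module.End k (M' → k)} (hT : Twines h ψ g T) (h0 : T ≠ 0) :
    Commute T (parity M' k) := by
  set P := parity M' k with hP
  have hPP : P * P = 1 := parity_mul_self
  have h1 : Twines h ψ g (P * T * P) := fun u => by
    rw [mul_assoc, parity_heis, ← mul_assoc, mul_assoc P, hT, ← mul_assoc, ← hP, hP, parity_heis,
      map_neg, neg_neg, mul_assoc, mul_assoc, mul_assoc]
  obtain ⟨c, hc⟩ := hT.unique hψ h0 h1
  have h3 : P * T = c • (T * P) := by
    rw [← smul_mul_assoc, ← hc, mul_assoc, hPP, mul_one]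
  have h4 : T = (c * c) • T := by
    calc T = P * (P * T * P) * P := by
            rw [mul_assoc P T P, ← mul_assoc P P, hPP, one_mul, mul_assoc, hPP, mul_one]
      _ = _ := by rw [hc, mul_smul_comm, smul_mul_assoc, hc, smul_smul]
  have h5 : c * c = 1 := by
    refine smul_left_injective k h0 ?_
    change (c * c) • T = (1 : k) • T
    rw [← h4]
    exact (one_smul k T).symm
  rcases mul_self_eq_one_iff.1 h5 with rfl | rfl
  · rw [one_smul] at h3; exact h3.symm
  · exfalso
    have h6 : T * evenProj M' k = oddProj M' k * T := by
      rw [evenProj, oddProj, mul_smul_comm, smul_mul_assoc, mul_add, sub_mul, ← hP, h3, mul_one, one_mul]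
      congr 1
      module
    have h7 : ∀ x ∈ LinearMap.range (evenProj M' k), T x ∈ LinearMap.range (oddProj M' k) := by
      rintro _ ⟨y, rfl⟩
      exact ⟨T y, (LinearMap.congr_fun h6 y).symm⟩
    have h8 := LinearMap.finrank_le_finrank_of_injective (f := T.restrict h7) (by
      intro x y hxy
      exact Subtype.ext (hT.injective hψ h0 (congrArg Subtype.val hxy)))
    rw [finrank_even h2] at h8
    omega

/-- The determinant of `T` on the odd functions divided by its determinant on the even functions
(for `T` commuting with the parity). -/
noncomputable def detRatio (T : Module.End k (M' → k)) : k :=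
  LinearMap.det (compress (oddProj M' k) T) / LinearMap.det (compress (evenProj M' k) T)

theorem detRatio_mul [CharZero k] {T S : Module.End k (M' → k)} (hS : Commute S (parity M' k)) :
    detRatio (T * S) = detRatio T * detRatio S := by
  have he : Commute S (evenProj M' k) :=
    ((Commute.one_right S).add_right hS).smul_right _
  have ho : Commute S (oddProj M' k) :=
    ((Commute.one_right S).sub_right hS).smul_right _
  rw [detRatio, detRatio, detRatio, compress_mul evenProj_idem he, compress_mul oddProj_idem ho,
    map_mul, map_mul, mul_div_mul_comm]

theorem detRatio_one [CharZero k] : detRatio (1 : Module.End k (M' → k)) = 1 := by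
  rw [detRatio, compress_one oddProj_idem, compress_one evenProj_idem, map_one, map_one, div_one]

theorem detRatio_smul [CharZero k] (h2 : (2 : F) ≠ 0) (T : Module.End k (M' → k)) {c : k}
    (hc : c ≠ 0) : detRatio (c • T) = c⁻¹ * detRatio T := by
  rw [detRatio, detRatio, compress_smul, compress_smul, LinearMap.det_smul, LinearMap.det_smul,
    finrank_even h2]
  field_simp
  ring

/-- **Existence of the Weil representation.** -/
theorem exists_isWeilRep [CharZero k] (h : IsPolarization B M M') (h2 : (2 : F) ≠ 0)
    {ψ : AddChar F k} (hψ : ψ ≠ 1) :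
    ∃ ω : Representation k (isometryGroup B) (M' → k),
      IsWeilRep h ψ ω ∧ ∀ g, detRatio (ω g) = 1 := by
  choose T hT hT0 using fun g => exists_twines (h := h) h2 hψ g
  refine ⟨{ toFun := fun g => detRatio (T g) • T g, map_one' := ?_, map_mul' := ?_ }, ?_, ?_⟩
  · have h1 : Twines h ψ (1 : isometryGroup B) (1 : Module.End k (M' → k)) := fun u => by
      rw [one_mul, mul_one]; rfl
    obtain ⟨c, hc⟩ := h1.unique hψ one_ne_zero (hT 1)
    have hc0 : c ≠ 0 := by rintro rfl; exact hT0 1 (by rw [hc, zero_smul])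
    rw [hc, detRatio_smul h2 _ hc0, detRatio_one, smul_smul, mul_one, inv_mul_cancel₀ hc0, one_smul]
  · intro a b
    have h1 : Twines h ψ ((a * b : isometryGroup B) : U ≃ₗ[F] U) (T a * T b) := (hT a).mul (hT b)
    obtain ⟨c, hc⟩ := (hT (a * b)).unique hψ (hT0 _) h1
    have hne : T a * T b ≠ 0 := by
      intro h0
      apply hT0 b
      refine LinearMap.ext fun f => ?_
      apply (hT a).injective hψ (hT0 a)
      rw [← Module.End.mul_apply, h0]; simp
    have hc0 : c ≠ 0 := by rintro rfl; exact hne (by rw [hc, zero_smul])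
    rw [smul_mul_smul_comm, ← detRatio_mul ((hT b).commute_parity h2 hψ (hT0 b)), hc,
      detRatio_smul h2 _ hc0, smul_smul]
    congr 1
    field_simp
  · intro g u
    change (detRatio (T g) • T g) * _ = _ * (detRatio (T g) • T g)
    rw [smul_mul_assoc, mul_smul_comm, hT g u]
  · intro g
    have h1 : Twines h ψ ((g * g⁻¹ : isometryGroup B) : U ≃ₗ[F] U) (T g * T g⁻¹) :=
      (hT g).mul (hT g⁻¹)
    have h3 : Twines h ψ ((g * g⁻¹ : isometryGroup B) : U ≃ₗ[F] U)
        (1 : Module.End k (M' → k)) := fun u => by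
      rw [mul_inv_cancel, one_mul, mul_one]; rfl
    obtain ⟨c, hc⟩ := h3.unique hψ one_ne_zero h1
    have hne : T g * T g⁻¹ ≠ 0 := by
      intro h0
      apply hT0 g⁻¹
      refine LinearMap.ext fun f => ?_
      apply (hT g).injective hψ (hT0 g)
      rw [← Module.End.mul_apply, h0]; simp
    have hc0 : c ≠ 0 := by rintro rfl; exact hne (by rw [hc, zero_smul])
    have h4 := detRatio_mul (T := T g) ((hT g⁻¹).commute_parity h2 hψ (hT0 g⁻¹))
    rw [hc, detRatio_smul h2 _ hc0, detRatio_one, mul_one] at h4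
    have h5 : detRatio (T g) ≠ 0 := by
      intro h0
      rw [h0, zero_mul] at h4
      exact inv_ne_zero hc0 h4
    change detRatio (detRatio (T g) • T g) = 1
    rw [detRatio_smul h2 _ h5, inv_mul_cancel₀ h5]

end parity

/-- The Weil representation of `Sp (U, B)` attached to `ψ`, on the functions on the Lagrangian `M'`.
The condition on `detRatio` singles out one representation with the property `IsWeilRep`. Since
`detRatio (ω g)` is a linear character of the isometry group, the condition is automatic whenever
that group is perfect, that is unless `dim U = 2` and `F` has three elements; in all other
cases there is exactly one Weil representation on this space, and this is it. -/
noncomputable def weilRep [CharZero k] (h : IsPolarization B M M') (hF : ringChar F ≠ 2)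
    {ψ : AddChar F k} (hψ : ψ ≠ 1) : Representation k (isometryGroup B) (M' → k) :=
  (exists_isWeilRep h (Ring.two_ne_zero hF) hψ).choose

theorem weilRep_isWeilRep [CharZero k] (h : IsPolarization B M M') (hF : ringChar F ≠ 2)
    {ψ : AddChar F k} (hψ : ψ ≠ 1) : IsWeilRep h ψ (weilRep h hF hψ) :=
  (exists_isWeilRep h (Ring.two_ne_zero hF) hψ).choose_spec.1

theorem detRatio_weilRep [CharZero k] (h : IsPolarization B M M') (hF : ringChar F ≠ 2)
    {ψ : AddChar F k} (hψ : ψ ≠ 1) (g : isometryGroup B) : detRatio (weilRep h hF hψ g) = 1 :=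
  (exists_isWeilRep h (Ring.two_ne_zero hF) hψ).choose_spec.2 g

end sums
end Weil

section DualPair

variable (F E : Type*) [Field F] [Fintype F] [Field E] [Algebra F E] [FiniteDimensional F E]

/-- `Sp(4, R)`: the matrices preserving the alternating form with matrix `J`. -/
abbrev Sp4 (R : Type*) [CommRing R] : Type _ := Matrix.symplecticGroup (Fin 2) R

/-- The standard four-dimensional space. -/
abbrev V : Type _ := Fin 2 ⊕ Fin 2 → F

/-- The symplectic form `⟨v, w⟩ = vᵀ J w` on `V`. -/
noncomputable def formV : LinearMap.BilinForm F (V F) := Matrix.toBilin' (Matrix.J (Fin 2) F)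

/-- The Lagrangian subspace `L` of `V` spanned by the first two basis vectors. -/
def lagL : Submodule F (V F) where
  carrier := {v | ∀ i, v (Sum.inr i) = 0}
  add_mem' ha hb i := by simp [ha i, hb i]
  zero_mem' i := rfl
  smul_mem' c v hv i := by simp [hv i]

/-- The complementary Lagrangian subspace, spanned by the last two basis vectors. -/
def lagL' : Submodule F (V F) where
  carrier := {v | ∀ i, v (Sum.inl i) = 0}
  add_mem' ha hb i := by simp [ha i, hb i]
  zero_mem' i := rfl
  smul_mem' c v hv i := by simp [hv i]

/-- The map `x ↦ x ^ q` of `E`. -/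
noncomputable def conjE : E ≃ₐ[F] E := FiniteField.frobeniusAlgEquivOfAlgebraic F E

/-- The form `⟨x, y⟩ = (x y ^ q + x ^ q y) / 2 = Tr (x y ^ q) / 2` on `E`, with values in `F`. -/
noncomputable def formE : LinearMap.BilinForm F E :=
  (2⁻¹ : F) • (Algebra.traceForm F E).compRight (conjE F E).toLinearMap

theorem formE_apply (x y : E) :
    formE F E x y = 2⁻¹ * Algebra.trace F E (x * y ^ Fintype.card F) := by
  simp [formE, conjE, LinearMap.BilinForm.compRight, LinearMap.BilinForm.comp]

theorem conjE_conjE (hE : Module.finrank F E = 2) (x : E) : conjE F E (conjE F E x) = x := by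
  have := Module.finite_of_finite F (M := E)
  have := Fintype.ofFinite E
  have h := FiniteField.pow_card x
  rw [Module.card_eq_pow_finrank (K := F), hE] at h
  simpa [conjE, ← pow_mul, ← pow_two] using h

theorem trace_conjE (x : E) : Algebra.trace F E (conjE F E x) = Algebra.trace F E x :=
  Algebra.trace_eq_of_algEquiv (conjE F E) x

theorem formE_conj (x y : E) : formE F E (conjE F E x) (conjE F E y) = formE F E x y := by
  have := trace_conjE F E (x * conjE F E y)
  rw [map_mul] at this
  simp [formE, LinearMap.BilinForm.compRight, LinearMap.BilinForm.comp, this]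

theorem formE_symm (hE : Module.finrank F E = 2) (x y : E) : formE F E x y = formE F E y x := by
  have := trace_conjE F E (x * conjE F E y)
  rw [map_mul, conjE_conjE F E hE, mul_comm] at this
  simp [formE, LinearMap.BilinForm.compRight, LinearMap.BilinForm.comp, this]

theorem algebraMap_formE (hE : Module.finrank F E = 2) (x y : E) :
    algebraMap F E (formE F E x y)
      = 2⁻¹ * (x * y ^ Fintype.card F + x ^ Fintype.card F * y) := by
  have hy := conjE_conjE F E hE y
  simp only [conjE, FiniteField.coe_frobeniusAlgEquivOfAlgebraic] at hy
  have := Module.finite_of_finite F (M := E)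
  rw [formE_apply, map_mul, FiniteField.algebraMap_trace_eq_sum_pow, hE, Finset.sum_range_succ,
    Finset.sum_range_one, map_inv₀, Nat.card_eq_fintype_card, pow_zero, pow_one, pow_one, mul_pow, hy,
    map_ofNat]

/-- The orthogonal group `O(E)`. -/
noncomputable abbrev OE : Subgroup (E ≃ₗ[F] E) := isometryGroup (formE F E)

/-- The conjugation `x ↦ x ^ q` as an element of `O(E)`. -/
noncomputable def sigmaE : OE F E := ⟨(conjE F E).toLinearEquiv, formE_conj F E⟩

/-- The symplectic form on `V ⊗ E`, the tensor product of the forms of `V` and `E`. -/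
noncomputable def formVE : LinearMap.BilinForm F (V F ⊗[F] E) :=
  LinearMap.BilinForm.tmul (formV F) (formE F E)

theorem formVE_tmul (v w : V F) (x y : E) :
    formVE F E (v ⊗ₜ x) (w ⊗ₜ y) = formV F v w * formE F E x y := by
  rw [formVE, LinearMap.BilinForm.tensorDistrib_tmul, smul_eq_mul, mul_comm]

/-- The subspace `L ⊗ E` of `V ⊗ E`. -/
noncomputable def lagLE : Submodule F (V F ⊗[F] E) := LinearMap.range ((lagL F).subtype.rTensor E)

/-- The complementary Lagrangian in `V ⊗ E`, tensor product of the second Lagrangian with `E`. -/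
noncomputable def lagLE' : Submodule F (V F ⊗[F] E) := LinearMap.range ((lagL' F).subtype.rTensor E)

theorem formV_apply (v w : V F) :
    formV F v w = ∑ i : Fin 2, (v (Sum.inr i) * w (Sum.inl i) - v (Sum.inl i) * w (Sum.inr i)) := by
  simp [formV, Matrix.toBilin'_apply, Matrix.J, Matrix.fromBlocks, Matrix.one_apply]
  ring

theorem formV_nondeg (v : V F) (h : ∀ w, formV F v w = 0) : v = 0 := by
  ext i
  rcases i with i | i
  · have := h (Pi.single (Sum.inr i) 1)
    simpa [formV_apply, Pi.single_apply] using this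
  · have := h (Pi.single (Sum.inl i) 1)
    simpa [formV_apply, Pi.single_apply] using this

theorem formE_nondeg (hF : ringChar F ≠ 2) (x : E) (h : ∀ y, formE F E x y = 0) : x = 0 := by
  have h2 : (2 : F) ≠ 0 := Ring.two_ne_zero hF
  refine (traceForm_nondegenerate F E).1 x fun y => ?_
  have := h ((conjE F E).symm y)
  simpa [formE, LinearMap.BilinForm.compRight, LinearMap.BilinForm.comp, h2] using this

theorem polarization (hF : ringChar F ≠ 2) (hE : Module.finrank F E = 2) :
    IsPolarization (formVE F E) (lagLE F E) (lagLE' F E) where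
  alt x := by
    have h2 : (2 : F) ≠ 0 := Ring.two_ne_zero hF
    have h : ∀ x y, formVE F E x y = - formVE F E y x := by
      intro x y
      induction x with
      | zero => simp
      | add a b ha hb => simp [ha, hb]; ring
      | tmul v e =>
        induction y with
        | zero => simp
        | add a b ha hb => simp [ha, hb]; ring
        | tmul w f =>
          rw [formVE_tmul, formVE_tmul, formE_symm F E hE e f, formV_apply, formV_apply]
          simp only [Fin.sum_univ_two]
          ring
    have h1 : 2 * formVE F E x x = 0 := by linear_combination h x x
    exact (mul_eq_zero.1 h1).resolve_left h2
  nondeg x hx := by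
    have e : formVE F E = TensorProduct.dualDistrib F (V F) E ∘ₗ
        TensorProduct.map (formV F) (formE F E) := by
      ext v x w y; simp [formVE, mul_comm]
    have i1 : Function.Injective (formV F) :=
      (injective_iff_map_eq_zero _).2 fun v hv => formV_nondeg F v fun w => by rw [hv]; rfl
    have i2 : Function.Injective (formE F E) :=
      (injective_iff_map_eq_zero _).2 fun v hv => formE_nondeg F E hF v fun w => by rw [hv]; rfl
    have i3 : Function.Injective (TensorProduct.dualDistrib F (V F) E) :=
      (TensorProduct.dualDistribEquiv F (V F) E).injective
    have i4 : Function.Injective (TensorProduct.map (formV F) (formE F E)) :=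
      TensorProduct.map_injective_of_flat_flat _ _ i1 i2
    have i5 : Function.Injective (formVE F E) := by rw [e]; exact i3.comp i4
    exact (injective_iff_map_eq_zero _).1 i5 x (LinearMap.ext hx)
  isotropic_left := by
    rintro _ ⟨x, rfl⟩ _ ⟨y, rfl⟩
    induction x with
    | zero => simp
    | add a b ha hb => simp [ha, hb]
    | tmul v e =>
      induction y with
      | zero => simp
      | add a b ha hb => simp only [map_add, ha, hb, add_zero]
      | tmul w f =>
        have h1 : ∀ i, (v : V F) (Sum.inr i) = 0 := v.2
        have h2 : ∀ i, (w : V F) (Sum.inr i) = 0 := w.2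
        simp [formVE_tmul, formV_apply, h1, h2]
  isotropic_right := by
    rintro _ ⟨x, rfl⟩ _ ⟨y, rfl⟩
    induction x with
    | zero => simp
    | add a b ha hb => simp [ha, hb]
    | tmul v e =>
      induction y with
      | zero => simp
      | add a b ha hb => simp only [map_add, ha, hb, add_zero]
      | tmul w f =>
        have h1 : ∀ i, (v : V F) (Sum.inl i) = 0 := v.2
        have h2 : ∀ i, (w : V F) (Sum.inl i) = 0 := w.2
        simp [formVE_tmul, formV_apply, h1, h2]
  isCompl := by
    let p : V F →ₗ[F] V F := LinearMap.pi (Sum.elim (fun i => LinearMap.proj (Sum.inl i)) 0)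
    have hp1 : ∀ x ∈ lagLE F E, p.rTensor E x = x := by
      rintro _ ⟨x, rfl⟩
      rw [← LinearMap.comp_apply, ← LinearMap.rTensor_comp]
      congr 2
      ext v i
      rcases i with i | i
      · simp [p]
      · simpa [p] using (v.2 i).symm
    have hp2 : ∀ x ∈ lagLE' F E, p.rTensor E x = 0 := by
      rintro _ ⟨x, rfl⟩
      rw [← LinearMap.comp_apply, ← LinearMap.rTensor_comp]
      have : p ∘ₗ (lagL' F).subtype = 0 := by
        ext v i
        rcases i with i | i
        · simpa [p] using v.2 i
        · simp [p]
      rw [this]; simp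
    refine ⟨Submodule.disjoint_def.2 fun x h1 h2 => by rw [← hp1 x h1, hp2 x h2], ?_⟩
    rw [codisjoint_iff, eq_top_iff]
    rintro x -
    induction x with
    | zero => exact zero_mem _
    | add a b ha hb => exact add_mem ha hb
    | tmul v e =>
      have h1 : p v ∈ lagL F := fun i => by simp [p]
      have h2 : v - p v ∈ lagL' F := fun i => by simp [p]
      have : v ⊗ₜ[F] e = p v ⊗ₜ e + (v - p v) ⊗ₜ e := by
        rw [← TensorProduct.add_tmul, add_sub_cancel]
      rw [this]
      exact Submodule.add_mem_sup ⟨(⟨p v, h1⟩ : lagL F) ⊗ₜ e, by simp⟩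
        ⟨(⟨v - p v, h2⟩ : lagL' F) ⊗ₜ e, by simp⟩

instance : Finite (V F ⊗[F] E) := Module.finite_of_finite F

variable {F E}

/-- The action of `Sp(4, F)` on `V`. -/
noncomputable def spLin (g : Sp4 F) : V F ≃ₗ[F] V F :=
  LinearEquiv.ofLinearMap (Matrix.toLin' (g : Matrix _ _ F))
    (Matrix.toLin' ((g⁻¹ : Sp4 F) : Matrix _ _ F))
    (by rw [← Matrix.toLin'_mul, ← Matrix.toLin'_one]
        exact congrArg _ (congrArg Subtype.val (mul_inv_cancel g)))
    (by rw [← Matrix.toLin'_mul, ← Matrix.toLin'_one]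
        exact congrArg _ (congrArg Subtype.val (inv_mul_cancel g)))

theorem spLin_apply (g : Sp4 F) (v : V F) : spLin g v = (g : Matrix _ _ F).mulVec v := by
  simp [spLin]

theorem formV_spLin (g : Sp4 F) (v w : V F) : formV F (spLin g v) (spLin g w) = formV F v w := by
  have h := SymplecticGroup.mem_iff'.1 g.2
  simp only [formV, Matrix.toBilin'_apply', spLin_apply]
  conv_rhs => rw [← h]
  rw [Matrix.dotProduct_mulVec, Matrix.vecMul_mulVec, Matrix.dotProduct_mulVec,
    Matrix.dotProduct_mulVec, Matrix.vecMul_vecMul]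

/-- `(g, t) ↦ g ⊗ t`. -/
noncomputable def tensorHom : Sp4 F × OE F E →* isometryGroup (formVE F E) where
  toFun p := ⟨TensorProduct.congr (spLin p.1) (p.2 : E ≃ₗ[F] E), by
    intro x y
    induction x with
    | zero => simp
    | add a b ha hb => simp only [map_add, LinearMap.add_apply, ha, hb]
    | tmul v e =>
      induction y with
      | zero => simp
      | add a b ha hb => simp only [map_add, ha, hb]
      | tmul w f =>
        rw [TensorProduct.congr_tmul, TensorProduct.congr_tmul, formVE_tmul, formVE_tmul,
          formV_spLin, p.2.2]⟩
  map_one' := by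
    ext x
    induction x with
    | zero => simp
    | add a b ha hb => simp only [map_add, ha, hb]
    | tmul v e => simp [spLin_apply]
  map_mul' p r := by
    ext x
    induction x with
    | zero => simp
    | add a b ha hb => simp only [map_add, ha, hb]
    | tmul v e => simp [spLin_apply]

variable {k : Type*} [Field k] [CharZero k]

/-- The Weil representation `W` of `Sp(V ⊗ E)`. -/
noncomputable def weilVE (hF : ringChar F ≠ 2) (hE : Module.finrank F E = 2) {ψ : AddChar F k}
    (hψ : ψ ≠ 1) : Representation k (isometryGroup (formVE F E)) (lagLE' F E → k) :=
  weilRep (polarization F E hF hE) hF hψ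

/-- The character `η` of the Weil representation of `Sp(V ⊗ E)`. -/
noncomputable def eta (hF : ringChar F ≠ 2) (hE : Module.finrank F E = 2) {ψ : AddChar F k}
    (hψ : ψ ≠ 1) (g : isometryGroup (formVE F E)) : k :=
  (weilVE hF hE hψ).character g

/-- The restriction of the Weil representation to `Sp(V)`, via `g ↦ g ⊗ 1`. -/
noncomputable def weilV (hF : ringChar F ≠ 2) (hE : Module.finrank F E = 2) {ψ : AddChar F k}
    (hψ : ψ ≠ 1) : Representation k (Sp4 F) (lagLE' F E → k) :=
  (weilVE hF hE hψ).comp (tensorHom.comp (MonoidHom.inl (Sp4 F) (OE F E)))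

/-- The subrepresentation `W₁⁻` of `Sp(V)` on `W`: the `(-1)`-eigenspace of the conjugation on the
space `W₁` of vectors fixed by `SO(E)`. -/
noncomputable def W1minus (hF : ringChar F ≠ 2) (hE : Module.finrank F E = 2) {ψ : AddChar F k}
    (hψ : ψ ≠ 1) : Subrepresentation (weilV hF hE hψ) where
  toSubmodule :=
    { carrier := {f | (∀ t : OE F E, LinearMap.det ((t : E ≃ₗ[F] E) : E →ₗ[F] E) = 1 →
          weilVE hF hE hψ (tensorHom (1, t)) f = f) ∧
          weilVE hF hE hψ (tensorHom (1, sigmaE F E)) f = -f}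
      add_mem' := fun {a b} ha hb => ⟨fun t ht => by rw [map_add, ha.1 t ht, hb.1 t ht], by
        rw [map_add, ha.2, hb.2, neg_add]⟩
      zero_mem' := ⟨fun t _ => map_zero _, by rw [map_zero, neg_zero]⟩
      smul_mem' := fun c f hf => ⟨fun t ht => by rw [map_smul, hf.1 t ht], by
        rw [map_smul, hf.2, smul_neg]⟩ }
  apply_mem_toSubmodule g f hf := by
    have hcomm : ∀ t : OE F E, weilVE hF hE hψ (tensorHom (1, t)) (weilV hF hE hψ g f)
        = weilV hF hE hψ g (weilVE hF hE hψ (tensorHom (1, t)) f) := fun t => by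
      change weilVE hF hE hψ (tensorHom (1, t)) (weilVE hF hE hψ (tensorHom (g, 1)) f)
        = weilVE hF hE hψ (tensorHom (g, 1)) (weilVE hF hE hψ (tensorHom (1, t)) f)
      rw [← Module.End.mul_apply, ← Module.End.mul_apply, ← map_mul, ← map_mul, ← map_mul,
        ← map_mul, Prod.mk_mul_mk, Prod.mk_mul_mk, one_mul, mul_one, one_mul, mul_one]
    exact ⟨fun t ht => by rw [hcomm, hf.1 t ht], by rw [hcomm, hf.2, map_neg]⟩

/-- The character `θ₁₀` of `Sp(4, F)`, i.e. the character of `W₁⁻`. -/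
noncomputable def theta10 (hF : ringChar F ≠ 2) (hE : Module.finrank F E = 2) {ψ : AddChar F k}
    (hψ : ψ ≠ 1) (g : Sp4 F) : k :=
  (W1minus hF hE hψ).toRepresentation.character g

end DualPair

section AlgebraicGroup

variable (K : Type*) [Field K]

/-- The Zariski topology on `Sp(4, K)`, as a subset of the affine space of `4 × 4` matrices: the closed
sets are the sets of zeros of families of polynomials in the matrix entries. -/
noncomputable abbrev zariski : TopologicalSpace (Sp4 K) :=
  TopologicalSpace.induced
    (fun g => MvPolynomial.pointToPoint (k := K)
      (fun ij : (Fin 2 ⊕ Fin 2) × (Fin 2 ⊕ Fin 2) => (g : Matrix _ _ K) ij.1 ij.2))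
    inferInstance

variable {K}

/-- A torus in `Sp(4, K)`, for `K` algebraically closed: a closed connected subgroup that is
diagonalizable. -/
structure IsTorus (T : Subgroup (Sp4 K)) : Prop where
  isClosed : @IsClosed _ (zariski K) (T : Set (Sp4 K))
  isConnected : @IsConnected _ (zariski K) (T : Set (Sp4 K))
  diagonalizable : ∃ P : GL (Fin 2 ⊕ Fin 2) K, ∀ g ∈ T,
    ((P⁻¹ : GL (Fin 2 ⊕ Fin 2) K).val * (g : Matrix _ _ K) * P.val).IsDiag

/-- A maximal torus: a torus that is not properly contained in another one. -/
def IsMaximalTorus (T : Subgroup (Sp4 K)) : Prop := Maximal IsTorus T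

/-- `s` is regular semisimple, for `K` algebraically closed: it is diagonalizable, and the identity
component of its centralizer is a maximal torus. -/
def IsRegularSemisimple (s : Sp4 K) : Prop :=
  (∃ P : GL (Fin 2 ⊕ Fin 2) K,
    ((P⁻¹ : GL (Fin 2 ⊕ Fin 2) K).val * (s : Matrix _ _ K) * P.val).IsDiag) ∧
  ∃ T : Subgroup (Sp4 K), IsMaximalTorus T ∧
    @connectedComponentIn _ (zariski K) (Subgroup.centralizer {s} : Subgroup (Sp4 K)) 1 = T

/-- The homomorphism `Sp(4, R) → Sp(4, S)` induced by a ring homomorphism. -/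
def spMap {R S : Type*} [CommRing R] [CommRing S] (φ : R →+* S) : Sp4 R →* Sp4 S :=
  ((φ.mapMatrix : Matrix (Fin 2 ⊕ Fin 2) (Fin 2 ⊕ Fin 2) R →+* _).toMonoidHom.comp
    (Submonoid.subtype _)).codRestrict (Matrix.symplecticGroup (Fin 2) S)
    (fun g => SymplecticGroup.map_mem g.2 φ)

theorem coe_spMap {R S : Type*} [CommRing R] [CommRing S] (φ : R →+* S) (g : Sp4 R) :
    (spMap φ g : Matrix (Fin 2 ⊕ Fin 2) (Fin 2 ⊕ Fin 2) S)
      = (g : Matrix (Fin 2 ⊕ Fin 2) (Fin 2 ⊕ Fin 2) R).map φ := rfl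

variable (F : Type*) [Field F] [Fintype F]

/-- The Frobenius endomorphism of `Sp(4, K)`: the `q`-th power map on matrix entries. -/
noncomputable def frob [Algebra F K] : Sp4 K →* Sp4 K :=
  spMap (FiniteField.frobeniusAlgHom F K : K →+* K)

theorem coe_frob [Algebra F K] (g : Sp4 K) (i j : Fin 2 ⊕ Fin 2) :
    (frob F g : Matrix (Fin 2 ⊕ Fin 2) (Fin 2 ⊕ Fin 2) K) i j
      = (g : Matrix (Fin 2 ⊕ Fin 2) (Fin 2 ⊕ Fin 2) K) i j ^ Fintype.card F := rfl

/-- The fixed points of the Frobenius endomorphism in a subgroup. -/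
noncomputable def fixedPoints [Algebra F K] (T : Subgroup (Sp4 K)) : Subgroup (Sp4 K) :=
  T ⊓ (frob F).eqLocus (MonoidHom.id (Sp4 K))

end AlgebraicGroup
end Theta10

/-!
Extend scalars to the algebraic closure `K` of `F`, with `q` elements in `F`. The rational points of
the torus form a subgroup `A` of `Sp(4, F)` of order `q ^ 2 + 1` whose elements are diagonalized over
`K` by a single matrix `P`. Apart from the regularity of `s`, which uses that `T` is a maximal torus,
the argument needs only this subgroup.

**Eigenvalues.** If `g` in `A` has an eigenvalue `x ≠ ± 1`, then `x ^ (q ^ 2) = x⁻¹`, and its four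
eigenvalues are the distinct Frobenius conjugates `x`, `x ^ q`, `x⁻¹`, `x ^ (-q)` (`exists_eig`). As
`q ^ 2 + 1 = 2 * m` with `m` odd, `x ^ m = ± 1`, and then `g ^ m = ± 1`. It follows that the elements
of `A` with square `1` are `± 1` (`sq_ne_one`), so `A` acts freely on the nonzero vectors
(`eq_one_of_mulVec_eq`) and `s` has four distinct eigenvalues. The centralizer of `s` is therefore
diagonalizable; its identity component is a torus containing `T`, hence equal to `T`
(`isRegularSemisimple_of_injective`).

**Rotations.** An isometry that preserves a polarization and is a square on one of its Lagrangians
has as its Weil character the number of its fixed points there (`character_weilRep_of_stable`). If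
`t` is multiplication by an element of norm one, the eigenspaces of `s + s⁻¹` in `V ⊗ E` over `E` are
such a polarization for `s ⊗ t`, and `0` is the only fixed vector (`eta_eq_one`).

**Reflections.** Otherwise `t` fixes `b₀` and negates `b₁` for a basis `b₀, b₁` of `E`. Let `ρ` be
the Schrödinger representation and `ω` the Weil representation. Then `ω (1 ⊗ t)` is a multiple of
`∑ w, ρ (w ⊗ b₁)` (`twines_reflection`), and comparing traces (`eta_one_reflection`) shows that the
factor is `q⁻²`. Conjugation by `ρ` gives the trace of `ρ (w ⊗ b₁) * ω (s ⊗ 1)`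
(`trace_heis_mul_weilRep`), so that `η (s ⊗ t) = q⁻² * ∑ w, ψ (c * ⟨w, s w⟩)` with `c ≠ 0`. By Gauss
sums the exponential sum is `± q ^ 2` (`sum_addChar_quadraticForm_sq`). Since `A` acts freely on the
nonzero vectors, it is congruent to `1` modulo `q ^ 2 + 1`, which leaves `-q ^ 2`
(`sum_addChar_eq_neg_of_free`). So `η (s ⊗ t) = -1` (`eta_eq_neg_one`).

**The character `θ₁₀`.** Averaging over `O(E)` against the sign character gives
`θ₁₀ s = |O(E)|⁻¹ * ∑ t, sgn t * η (s ⊗ t)` (`theta10_eq_sum`), in which every term is `1`.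
-/

namespace Theta10

/-! ### The Weil representation on stabilizers of polarizations -/

section Levi

/-- The dot product of functions on a finite type, as a bilinear form. -/
noncomputable def dotForm (k X : Type*) [Field k] [Fintype X] : LinearMap.BilinForm k (X → k) :=
  LinearMap.mk₂ k (fun f g => ∑ x, f x * g x)
    (fun f f' g => by simp [add_mul, Finset.sum_add_distrib])
    (fun c f g => by simp [Finset.mul_sum, mul_assoc])
    (fun f g g' => by simp [mul_add, Finset.sum_add_distrib])
    (fun c f g => by simp [Finset.mul_sum, mul_left_comm])

theorem dotForm_apply {k X : Type*} [Field k] [Fintype X] (f g : X → k) :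
    dotForm k X f g = ∑ x, f x * g x := rfl

theorem det_sq_eq_one_of_isometry {k W : Type*} [Field k] [AddCommGroup W] [Module k W]
    [FiniteDimensional k W] {β : LinearMap.BilinForm k W}
    (hβ : ∀ x, (∀ y, β x y = 0) → x = 0) {f : Module.End k W}
    (hf : ∀ x y, β (f x) (f y) = β x y) : LinearMap.det f ^ 2 = 1 := by
  classical
  let b := Module.finBasis k W
  have h1 : β.comp f f = β := by ext x y; exact hf x y
  have h2 := LinearMap.BilinForm.toMatrix_comp b b β f f
  rw [h1] at h2
  have h3 := congrArg Matrix.det h2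
  rw [Matrix.det_mul, Matrix.det_mul, Matrix.det_transpose, LinearMap.det_toMatrix] at h3
  have h4 : (LinearMap.BilinForm.toMatrix b β).det ≠ 0 :=
    (LinearMap.BilinForm.nondegenerate_iff_det_ne_zero b).1
      (.ofSeparatingLeft hβ)
  have : (LinearMap.BilinForm.toMatrix b β).det * (LinearMap.det f ^ 2 - 1) = 0 := by
    linear_combination -h3
  exact sub_eq_zero.1 ((mul_eq_zero.1 this).resolve_left h4)

/-- If `e` is an orthogonal projection and `T` is an orthogonal operator commuting with it, then `T`
is orthogonal on the range of `e`. -/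
theorem det_compress_sq {k X : Type*} [Field k] [Fintype X] {e T : Module.End k (X → k)}
    (he : e * e = e) (hs : ∀ f g, dotForm k X (e f) g = dotForm k X f (e g))
    (hT : ∀ f g, dotForm k X (T f) (T g) = dotForm k X f g) (hc : Commute T e) :
    LinearMap.det (compress e T) ^ 2 = 1 := by
  classical
  have he' : ∀ f, e (e f) = e f := fun f => LinearMap.congr_fun he f
  have hr : ∀ x : LinearMap.range e, ((compress e T x : LinearMap.range e) : X → k) = T x := by
    rintro ⟨_, y, rfl⟩
    change e (T (e y)) = T (e y)
    rw [← Module.End.mul_apply T e, hc.eq]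
    exact he' _
  refine det_sq_eq_one_of_isometry
    (β := (dotForm k X).compl₁₂ (LinearMap.range e).subtype (LinearMap.range e).subtype) ?_ ?_
  · rintro ⟨_, y, rfl⟩ h
    ext x
    have h1 : dotForm k X (e y) (e (Pi.single x 1)) = 0 := h ⟨_, Pi.single x 1, rfl⟩
    rw [← hs, he', dotForm_apply, Finset.sum_eq_single x] at h1
    · simpa using h1
    · intro z _ hz; simp [hz]
    · simp
  · intro x y
    simp only [LinearMap.compl₁₂_apply, Submodule.subtype_apply, hr]
    exact hT _ _

variable {F : Type*} [Field F] {U : Type*} [AddCommGroup U] [Module F U]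
  {B : LinearMap.BilinForm F U} {M M' : Submodule F U} {k : Type*} [Field k]

variable (k) in
/-- The permutation operator `f ↦ f ∘ a⁻¹`. -/
noncomputable def permOp (a : M' ≃ₗ[F] M') : Module.End k (M' → k) := LinearMap.funLeft k k a.symm

theorem permOp_mul (a b : M' ≃ₗ[F] M') : permOp k (a * b) = permOp k a * permOp k b := by
  ext; simp [permOp, LinearMap.funLeft]; rfl

theorem permOp_commute_parity (a : M' ≃ₗ[F] M') : Commute (permOp k a) (parity M' k) := by
  refine LinearMap.ext fun f => funext fun x => ?_
  simp [permOp, parity, LinearMap.funLeft_apply]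

variable [Finite U]

/-- Permutation operators are orthogonal for the dot product, and `parity` is self-adjoint. -/
theorem detRatio_permOp_sq [CharZero k] (a : M' ≃ₗ[F] M') : detRatio (permOp k a) ^ 2 = 1 := by
  have := Fintype.ofFinite M'
  have hP : ∀ f g, dotForm k M' (parity M' k f) g = dotForm k M' f (parity M' k g) := fun f g => by
    rw [dotForm_apply, dotForm_apply, ← Equiv.sum_comp (Equiv.neg M')]
    simp [parity, LinearMap.funLeft_apply]
  have hT : ∀ f g, dotForm k M' (permOp k a f) (permOp k a g) = dotForm k M' f g := fun f g => by
    rw [dotForm_apply, dotForm_apply, ← Equiv.sum_comp a.toEquiv]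
    simp [permOp, LinearMap.funLeft_apply]
  have hc := permOp_commute_parity (k := k) a
  rw [detRatio, div_pow, det_compress_sq oddProj_idem _ hT
      (((Commute.one_right _).sub_right hc).smul_right _),
    det_compress_sq evenProj_idem _ hT (((Commute.one_right _).add_right hc).smul_right _), div_one]
  · intro f g; simp [evenProj, hP]
  · intro f g; simp [oddProj, hP]

theorem permOp_ne_zero (a : M' ≃ₗ[F] M') : permOp k a ≠ 0 := by
  intro h
  have := congrFun (LinearMap.congr_fun h (fun _ => 1)) 0
  simp [permOp, LinearMap.funLeft_apply] at this

theorem trace_permOp (a : M' ≃ₗ[F] M') :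
    LinearMap.trace k _ (permOp k a) = Nat.card {x : M' // a x = x} := by
  classical
  have := Fintype.ofFinite M'
  rw [LinearMap.trace_eq_matrix_trace k (Pi.basisFun k M'), Matrix.trace]
  simp only [Matrix.diag_apply, LinearMap.toMatrix_apply, Pi.basisFun_apply, Pi.basisFun_repr,
    permOp, LinearMap.funLeft_apply, Pi.single_apply, Finset.sum_boole]
  rw [Nat.card_eq_fintype_card, Fintype.card_subtype]
  congr 2
  ext x
  simp only [Finset.mem_filter, Finset.mem_univ, true_and]
  rw [eq_comm, LinearEquiv.eq_symm_apply]

section normalization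

variable [CharZero k] (h : IsPolarization B M M') (hF : ringChar F ≠ 2) {ψ : AddChar F k}
  (hψ : ψ ≠ 1)

theorem weilRep_mul_inv (g : isometryGroup B) : weilRep h hF hψ g * weilRep h hF hψ g⁻¹ = 1 := by
  rw [← map_mul, mul_inv_cancel, map_one]

theorem weilRep_ne_zero (g : isometryGroup B) : weilRep h hF hψ g ≠ 0 := by
  intro h0
  have := weilRep_mul_inv h hF hψ g
  rw [h0, zero_mul] at this
  exact zero_ne_one this

/-- An operator implementing `g` is unique up to a scalar, which the condition on `detRatio` pins. -/
theorem weilRep_eq_of_twines {g : isometryGroup B} {T : Module.End k (M' → k)}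
    (hT : Twines h ψ g T) (h0 : T ≠ 0) (hd : detRatio T = 1) : weilRep h hF hψ g = T := by
  obtain ⟨c, hc⟩ := hT.unique hψ h0 (weilRep_isWeilRep h hF hψ g)
  have hc0 : c ≠ 0 := by
    rintro rfl
    exact weilRep_ne_zero h hF hψ g (by rw [hc, zero_smul])
  have h1 := detRatio_weilRep h hF hψ g
  rw [hc, detRatio_smul (Ring.two_ne_zero hF) _ hc0, hd, mul_one, inv_eq_one] at h1
  rw [hc, h1, one_smul]

/-- An operator implementing `g` is unique up to a scalar, which a nonzero trace determines. -/
theorem weilRep_eq_smul_of_twines {g : isometryGroup B} {T : Module.End k (M' → k)}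
    (hT : Twines h ψ g T) (h0 : LinearMap.trace k _ T ≠ 0) :
    weilRep h hF hψ g
      = (LinearMap.trace k _ (weilRep h hF hψ g) / LinearMap.trace k _ T) • T := by
  have hT0 : T ≠ 0 := by rintro rfl; simp at h0
  obtain ⟨c, hc⟩ := hT.unique hψ hT0 (weilRep_isWeilRep h hF hψ g)
  rw [hc, map_smul, smul_eq_mul, mul_div_cancel_right₀ _ h0]

theorem twines_permOp {g : isometryGroup B} (a : M' ≃ₗ[F] M')
    (ha : ∀ x : M', (g : U ≃ₗ[F] U) x = a x) (hM : ∀ x ∈ M, (g : U ≃ₗ[F] U) x ∈ M) :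
    Twines h ψ g (permOp k a) := by
  intro u
  obtain ⟨m, m', rfl⟩ := exists_decomp h u
  have e : (g : U ≃ₗ[F] U) (m + m') = ((⟨_, hM m m.2⟩ : M) : U) + (a m' : M') := by
    rw [map_add, ha]
  rw [e]
  refine LinearMap.ext fun f => funext fun x => ?_
  obtain ⟨y, rfl⟩ := a.surjective x
  rw [Module.End.mul_apply, Module.End.mul_apply, heis_apply, permOp, LinearMap.funLeft_apply,
    LinearMap.funLeft_apply, heis_apply]
  simp only [LinearEquiv.symm_apply_apply, map_sub]
  rw [← ha, ← ha, g.2, g.2]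

/-- The character on the stabilizer of the model polarization. The operators attached to that
stabilizer are permutation operators up to a sign character, which is trivial on squares. -/
theorem trace_weilRep_of_stable {g : isometryGroup B} (hM : ∀ x ∈ M, (g : U ≃ₗ[F] U) x ∈ M)
    (b : Module.End F U) (hb : ∀ x ∈ M', b x ∈ M') (hbb : ∀ x ∈ M', b (b x) = (g : U ≃ₗ[F] U) x) :
    LinearMap.trace k _ (weilRep h hF hψ g)
      = Nat.card {x : U // x ∈ M' ∧ (g : U ≃ₗ[F] U) x = x} := by
  let b₀ : M' →ₗ[F] M' := b.restrict hb
  have hinj : Function.Injective b₀ := by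
    intro x y hxy
    have h1 : b x = b y := congrArg Subtype.val hxy
    have h2 := hbb x x.2
    rw [h1, hbb y y.2] at h2
    exact Subtype.ext ((g : U ≃ₗ[F] U).injective h2.symm)
  have := Module.Finite.of_finite (R := F) (M := M')
  let b₁ : M' ≃ₗ[F] M' := LinearEquiv.ofInjectiveEndo b₀ hinj
  have hb₁ : ∀ x : M', (g : U ≃ₗ[F] U) x = ((b₁ * b₁) x : M') := fun x => (hbb x x.2).symm
  rw [weilRep_eq_of_twines h hF hψ (twines_permOp h (b₁ * b₁) hb₁ hM) (permOp_ne_zero _) (by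
    rw [permOp_mul, detRatio_mul (permOp_commute_parity _), ← sq, detRatio_permOp_sq]), trace_permOp]
  congr 1
  refine Nat.card_congr ⟨fun x => ⟨x.1, x.1.2, by rw [hb₁, x.2]⟩,
    fun x => ⟨⟨x.1, x.2.1⟩, Subtype.ext (by rw [← hb₁]; exact x.2.2)⟩, fun _ => rfl, fun _ => rfl⟩

end normalization

section transitivity

theorem finrank_eq_of_polarization (h : IsPolarization B M M') :
    Module.finrank F M = Module.finrank F M' := by
  have := Module.Finite.of_finite (R := F) (M := M')
  have := Module.Finite.of_finite (R := F) (M := M)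
  apply le_antisymm
  · rw [← Subspace.dual_finrank_eq (K := F) (V := M')]
    refine LinearMap.finrank_le_finrank_of_injective
      (f := B.compl₁₂ M.subtype M'.subtype) ((injective_iff_map_eq_zero _).2 fun m hm => ?_)
    by_contra hne
    exact pair_left_ne h m hne (LinearMap.ext fun x => LinearMap.congr_fun hm x)
  · rw [← Subspace.dual_finrank_eq (K := F) (V := M)]
    refine LinearMap.finrank_le_finrank_of_injective
      (f := (B.compl₁₂ M.subtype M'.subtype).flip) ((injective_iff_map_eq_zero _).2 fun m hm => ?_)
    by_contra hne
    exact pair_right_ne h m hne (LinearMap.ext fun x => LinearMap.congr_fun hm x)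

/-- The isomorphism of a Lagrangian with the dual of a complementary one. -/
noncomputable def pairEquiv (h : IsPolarization B M M') : M ≃ₗ[F] Module.Dual F M' :=
  haveI := Module.Finite.of_finite (R := F) (M := M')
  haveI := Module.Finite.of_finite (R := F) (M := M)
  LinearMap.linearEquivOfInjective (B.compl₁₂ M.subtype M'.subtype)
    ((injective_iff_map_eq_zero _).2 fun m hm => by
      by_contra hne
      exact pair_left_ne h m hne (LinearMap.ext fun x => LinearMap.congr_fun hm x))
    (by rw [Subspace.dual_finrank_eq, finrank_eq_of_polarization h])

theorem pairEquiv_apply (h : IsPolarization B M M') (m : M) (x : M') :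
    pairEquiv h m x = B m x := rfl

/-- The isometry group acts transitively on polarizations. -/
theorem exists_isometry_of_polarizations (h : IsPolarization B M M') {N N' : Submodule F U}
    (h' : IsPolarization B N N') :
    ∃ c : isometryGroup B, (∀ x ∈ M, (c : U ≃ₗ[F] U) x ∈ N) ∧ ∀ x ∈ M', (c : U ≃ₗ[F] U) x ∈ N' := by
  have := Module.Finite.of_finite (R := F) (M := U)
  have e1 := Submodule.finrank_add_eq_of_isCompl h.isCompl
  have e2 := Submodule.finrank_add_eq_of_isCompl h'.isCompl
  rw [finrank_eq_of_polarization h] at e1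
  rw [finrank_eq_of_polarization h'] at e2
  let α : M' ≃ₗ[F] N' := LinearEquiv.ofFinrankEq M' N' (by omega)
  let β : M ≃ₗ[F] N := pairEquiv h ≪≫ₗ α.symm.dualMap ≪≫ₗ (pairEquiv h').symm
  have hβ : ∀ (m : M) (x : M'), B (β m) (α x) = B m x := fun m x => by
    rw [← pairEquiv_apply h', ← pairEquiv_apply h]
    simp [β]
  let c : U ≃ₗ[F] U := (Submodule.prodEquivOfIsCompl M M' h.isCompl).symm ≪≫ₗ
    (β.prodCongr α) ≪≫ₗ Submodule.prodEquivOfIsCompl N N' h'.isCompl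
  have hc : ∀ (m : M) (x : M'), c (m + x) = β m + α x := fun m x => by
    have : (m + x : U) = Submodule.prodEquivOfIsCompl M M' h.isCompl (m, x) := by simp
    rw [this]
    simp [c]
  refine ⟨⟨c, fun u v => ?_⟩, fun x hx => ?_, fun x hx => ?_⟩
  · obtain ⟨m, m', rfl⟩ := exists_decomp h u
    obtain ⟨n, n', rfl⟩ := exists_decomp h v
    rw [hc, hc]
    simp only [map_add, LinearMap.add_apply, h'.isotropic_left _ (β m).2 _ (β n).2, hβ,
      h'.isotropic_right _ (α m').2 _ (α n').2, h.isotropic_left _ m.2 _ n.2,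
      h.isotropic_right _ m'.2 _ n'.2, skew h' (α m') (β n), skew h m' n]
  · have := hc ⟨x, hx⟩ 0
    simp only [ZeroMemClass.coe_zero, add_zero, map_zero] at this
    exact this ▸ (β _).2
  · have := hc 0 ⟨x, hx⟩
    simp only [ZeroMemClass.coe_zero, zero_add, map_zero] at this
    exact this ▸ (α _).2

end transitivity

/-- The character of the Weil representation at an element stabilizing a polarization, which need
not be the one of the model. -/
theorem character_weilRep_of_stable [CharZero k] (h : IsPolarization B M M') (hF : ringChar F ≠ 2)
    {ψ : AddChar F k} (hψ : ψ ≠ 1) {N N' : Submodule F U} (h' : IsPolarization B N N')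
    {g : isometryGroup B} (hN : ∀ x ∈ N, (g : U ≃ₗ[F] U) x ∈ N)
    (b : Module.End F U) (hb : ∀ x ∈ N', b x ∈ N') (hbb : ∀ x ∈ N', b (b x) = (g : U ≃ₗ[F] U) x) :
    (weilRep h hF hψ).character g = Nat.card {x : U // x ∈ N' ∧ (g : U ≃ₗ[F] U) x = x} := by
  obtain ⟨c, hcN, hcN'⟩ := exists_isometry_of_polarizations h h'
  obtain ⟨d, hdM, hdM'⟩ := exists_isometry_of_polarizations h' h
  -- an isometry carrying one polarization to the other carries it onto the other
  have onto : ∀ {P Q : Submodule F U} (c d : U ≃ₗ[F] U), (∀ x ∈ P, c x ∈ Q) → (∀ x ∈ Q, d x ∈ P) →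
      ∀ x ∈ Q, c.symm x ∈ P := by
    intro P Q c d hc hd x hx
    have := Module.Finite.of_finite (R := F) (M := U)
    have i1 : P.map (c : U →ₗ[F] U) ≤ Q := by rintro _ ⟨y, hy, rfl⟩; exact hc y hy
    have i2 : Q.map (d : U →ₗ[F] U) ≤ P := by rintro _ ⟨y, hy, rfl⟩; exact hd y hy
    have i3 := Submodule.finrank_mono i2
    rw [LinearEquiv.finrank_map_eq] at i3
    have i4 := Submodule.eq_of_le_of_finrank_le i1 (by rwa [LinearEquiv.finrank_map_eq])
    rw [← i4] at hx
    obtain ⟨y, hy, rfl⟩ := hx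
    simpa using hy
  have hcN2 := onto (c : U ≃ₗ[F] U) d hcN hdM
  have hcN2' := onto (c : U ≃ₗ[F] U) d hcN' hdM'
  have e : g = c * (c⁻¹ * g * c) * c⁻¹ := by group
  have hconj : ∀ x, ((c⁻¹ * g * c : isometryGroup B) : U ≃ₗ[F] U) x
      = (c : U ≃ₗ[F] U).symm ((g : U ≃ₗ[F] U) ((c : U ≃ₗ[F] U) x)) := fun x => rfl
  rw [e, Representation.char_conj, Representation.character, trace_weilRep_of_stable h hF hψ
    (g := c⁻¹ * g * c) (fun x hx => hcN2 _ (hN _ (hcN x hx)))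
    ((c : U ≃ₗ[F] U).symm.toLinearMap ∘ₗ b ∘ₗ (c : U ≃ₗ[F] U).toLinearMap)
    (fun x hx => hcN2' _ (hb _ (hcN' x hx)))
    (fun x hx => by
      rw [hconj, ← hbb _ (hcN' x hx)]
      simp), ← e]
  congr 1
  refine Nat.card_congr ⟨fun x => ⟨(c : U ≃ₗ[F] U) x.1, hcN' _ x.2.1, ?_⟩,
    fun x => ⟨(c : U ≃ₗ[F] U).symm x.1, hcN2' _ x.2.1, ?_⟩,
    fun _ => Subtype.ext (by simp), fun _ => Subtype.ext (by simp)⟩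
  · have := x.2.2
    rwa [hconj, LinearEquiv.symm_apply_eq] at this
  · rw [hconj, LinearEquiv.apply_symm_apply, x.2.2]

/-- Conjugating `ω g` by `ρ u` multiplies it by a multiple of `ρ ((g - 1) u)`, so the traces of
these products are known up to the trace of `ω g`. -/
theorem trace_heis_mul_weilRep [CharZero k] (h : IsPolarization B M M') (hF : ringChar F ≠ 2)
    {ψ : AddChar F k} (hψ : ψ ≠ 1) (g : isometryGroup B) (u : U) :
    LinearMap.trace k _ (heisenbergOp h ψ ((g : U ≃ₗ[F] U) u - u) * weilRep h hF hψ g)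
      = ψ (2⁻¹ * B u ((g : U ≃ₗ[F] U) u)) * (weilRep h hF hψ).character g := by
  have h2 := Ring.two_ne_zero hF
  have h1 : heisenbergOp h ψ (-u) * (weilRep h hF hψ g * heisenbergOp h ψ u)
      = ψ (2⁻¹ * B (-u) ((g : U ≃ₗ[F] U) u)) •
        (heisenbergOp h ψ ((g : U ≃ₗ[F] U) u - u) * weilRep h hF hψ g) := by
    rw [weilRep_isWeilRep h hF hψ g u, ← mul_assoc, heis_mul h h2, smul_mul_assoc, neg_add_eq_sub]
  have h3 := congrArg (LinearMap.trace k _) h1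
  rw [LinearMap.trace_mul_comm, mul_assoc, heis_mul h h2, map_smul, smul_eq_mul] at h3
  simp only [map_neg, LinearMap.neg_apply, h.alt, neg_zero, mul_zero, AddChar.map_zero_eq_one,
    one_smul, add_neg_cancel, heis_zero, mul_one, mul_neg] at h3
  rw [Representation.character, h3, ← mul_assoc, ← AddChar.map_add_eq_mul, add_neg_cancel,
    AddChar.map_zero_eq_one, one_mul]

end Levi

/-! ### Gauss sums of quadratic forms -/

section GaussSums

variable {F : Type*} [Field F] [Fintype F] {k : Type*} [Field k] [CharZero k]

/-- Counting square roots turns the sum into the Gauss sum of the quadratic character. -/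
theorem sum_addChar_mul_sq_sq [DecidableEq F] (hF : ringChar F ≠ 2) {ψ : AddChar F k} (hψ : ψ ≠ 1)
    {a : F} (ha : a ≠ 0) :
    (∑ x, ψ (a * x ^ 2)) ^ 2 = ((quadraticChar F (-1) : ℤ) : k) * Fintype.card F := by
  have h1 : ψ.mulShift a ≠ 1 := AddChar.IsPrimitive.of_ne_one hψ ha
  set χ : MulChar F k := (quadraticChar F).ringHomComp (Int.castRingHom k) with hχ
  have h2 : ∑ x, ψ (a * x ^ 2) = gaussSum χ (ψ.mulShift a) := by
    have e1 : ∑ x : F, ψ.mulShift a (x ^ 2)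
        = ∑ b : F, ∑ x ∈ Finset.univ.filter (fun x : F => x ^ 2 = b), ψ.mulShift a (x ^ 2) :=
      (Finset.sum_fiberwise _ _ _).symm
    have e2 : ∀ b : F, ∑ x ∈ Finset.univ.filter (fun x : F => x ^ 2 = b), ψ.mulShift a (x ^ 2)
        = χ b * ψ.mulShift a b + ψ.mulShift a b := fun b => by
      have h3 := quadraticChar_card_sqrts hF b
      have h4 : ({x : F | x ^ 2 = b}.toFinset) = Finset.univ.filter (fun x : F => x ^ 2 = b) := by
        ext; simp
      rw [h4] at h3
      have h5 : ((Finset.univ.filter (fun x : F => x ^ 2 = b)).card : k) = χ b + 1 := by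
        rw [hχ, MulChar.ringHomComp_apply, eq_intCast]
        exact_mod_cast congrArg (Int.cast : ℤ → k) h3
      rw [Finset.sum_congr rfl (fun x hx => by rw [(Finset.mem_filter.1 hx).2]), Finset.sum_const,
        nsmul_eq_mul, h5, add_mul, one_mul]
    change ∑ x : F, ψ.mulShift a (x ^ 2) = _
    rw [e1, Finset.sum_congr rfl (fun b _ => e2 b), Finset.sum_add_distrib,
      AddChar.sum_eq_zero_of_ne_one h1, add_zero]
    rfl
  rw [h2, gaussSum_sq]
  · rw [hχ, MulChar.ringHomComp_apply, eq_intCast]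
  · obtain ⟨u, hu⟩ := quadraticChar_exists_neg_one hF
    refine MulChar.ne_one_iff.2 ?_
    have hu0 : u ≠ 0 := by rintro rfl; simp at hu
    refine ⟨Units.mk0 u hu0, ?_⟩
    rw [hχ, MulChar.ringHomComp_apply, Units.val_mk0, hu]
    norm_num
  · exact (quadraticChar_isQuadratic F).comp _
  · exact AddChar.IsPrimitive.of_ne_one h1

/-- Diagonalizing the form reduces its Gauss sum to products of one-variable Gauss sums. -/
theorem sum_addChar_quadraticForm_sq [DecidableEq F] {W : Type*} [AddCommGroup W] [Module F W]
    [Fintype W] (hF : ringChar F ≠ 2) {ψ : AddChar F k} (hψ : ψ ≠ 1) [Invertible (2 : F)]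
    (Q : QuadraticForm F W)
    (hQ : LinearMap.SeparatingLeft (QuadraticMap.associated (R := F) Q)) :
    (∑ w, ψ (Q w)) ^ 2
      = (((quadraticChar F (-1) : ℤ) : k) * Fintype.card F) ^ Module.finrank F W := by
  have := Module.Finite.of_finite (R := F) (M := W)
  obtain ⟨w, ⟨e⟩⟩ := Q.equivalent_weightedSumSquares_units_of_nondegenerate' hQ
  have h1 : ∑ x, ψ (Q x) = ∏ i, ∑ t : F, ψ ((w i : F) * t ^ 2) := by
    rw [Finset.prod_univ_sum, Fintype.piFinset_univ, ← Equiv.sum_comp e.symm.toEquiv]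
    refine Finset.sum_congr rfl fun x _ => ?_
    have : Q (e.symm x) = ∑ i, (w i : F) * x i ^ 2 := by
      rw [e.symm.map_app, QuadraticMap.weightedSumSquares_apply]
      simp [Units.smul_def, sq]
    change ψ (Q (e.symm x)) = _
    rw [this]
    exact map_prod ψ.toMonoidHom _ _
  rw [h1, ← Finset.prod_pow, Finset.prod_congr rfl
    (fun i _ => sum_addChar_mul_sq_sq hF hψ (w i).ne_zero)]
  simp

theorem isIntegral_addChar (ψ : AddChar F k) (a : F) : IsIntegral ℤ (ψ a) := by
  refine IsIntegral.of_pow (n := Fintype.card F) Fintype.card_pos ?_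
  rw [← AddChar.map_nsmul_eq_pow, card_nsmul_eq_zero, AddChar.map_zero_eq_one]
  exact isIntegral_one

/-- A group of order `n + 1` acting freely on the nonzero vectors and preserving `Q` forces the
exponential sum of `Q` to be `1` modulo `n + 1`, which determines the sign of a sum `± n`. -/
theorem sum_addChar_eq_neg_of_free {W A : Type*} [AddCommGroup W] [Fintype W] [Group A]
    [DistribMulAction A W] (ψ : AddChar F k) (Q : W → F) (hQ0 : Q 0 = 0)
    (hQ : ∀ (a : A) (w : W), Q (a • w) = Q w)
    (hfree : ∀ (a : A) (w : W), a • w = w → w ≠ 0 → a = 1) {n : ℕ} (hn : 2 ≤ n)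
    (hA : Nat.card A = n + 1) (hS : (∑ w, ψ (Q w)) ^ 2 = (n : k) ^ 2) :
    ∑ w, ψ (Q w) = -n := by
  classical
  -- the orbits in each level set of `Q` have `n + 1` elements
  have hfib : ∀ c : F, ∃ m : ℕ,
      ((Finset.univ.filter (fun w : W => w ≠ 0)).filter (fun w => Q w = c)).card
        = (n + 1) * m := fun c => by
    let X : SubMulAction A W :=
      { carrier := {w | w ≠ 0 ∧ Q w = c}
        smul_mem' := fun a w hw => ⟨(smul_ne_zero_iff_ne a).2 hw.1, by rw [hQ, hw.2]⟩ }
    have hst : ∀ x : X, MulAction.stabilizer A x = ⊥ := fun x => by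
      rw [eq_bot_iff]
      intro a ha
      exact hfree a x (congrArg Subtype.val (MulAction.mem_stabilizer_iff.1 ha)) x.2.1
    have h1 := Nat.card_congr (MulAction.selfEquivOrbitsQuotientProd hst)
    rw [Nat.card_prod, hA, mul_comm] at h1
    refine ⟨_, Eq.trans ?_ h1⟩
    rw [Finset.filter_filter, ← Fintype.card_subtype, ← Nat.card_eq_fintype_card]
    rfl
  choose m hm using hfib
  have h1 : ∑ w, ψ (Q w) = 1 + (n + 1) * ∑ c : F, (m c : k) * ψ c := by
    rw [← Finset.sum_filter_add_sum_filter_not Finset.univ (fun w : W => w = 0),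
      Finset.filter_eq' Finset.univ (0 : W), if_pos (Finset.mem_univ _), Finset.sum_singleton, hQ0,
      AddChar.map_zero_eq_one, ← Finset.sum_fiberwise (Finset.univ.filter (fun w : W => ¬ w = 0)) Q,
      Finset.mul_sum]
    congr 1
    refine Finset.sum_congr rfl fun c _ => ?_
    rw [Finset.sum_congr rfl (fun w hw => by rw [(Finset.mem_filter.1 hw).2]), Finset.sum_const,
      nsmul_eq_mul]
    have := hm c
    simp only [ne_eq] at this
    rw [this]
    push_cast
    ring
  -- the value `n` would make `(n - 1) / (n + 1)` an algebraic integer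
  rcases sq_eq_sq_iff_eq_or_eq_neg.1 hS with h2 | h2
  · exfalso
    have hn1 : (n : k) + 1 ≠ 0 := by exact_mod_cast Nat.succ_ne_zero n
    have hint : IsIntegral ℤ (∑ c : F, (m c : k) * ψ c) := by
      refine IsIntegral.sum _ fun c _ => IsIntegral.mul ?_ (isIntegral_addChar ψ c)
      simpa using isIntegral_algebraMap (R := ℤ) (A := k) (x := (m c : ℤ))
    have h3 : (∑ c : F, (m c : k) * ψ c) = algebraMap ℚ k ((n - 1) / (n + 1)) := by
      rw [h1] at h2
      simp only [map_div₀, map_sub, map_add, map_natCast, map_one]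
      rw [eq_div_iff hn1]
      linear_combination h2
    rw [h3, isIntegral_algebraMap_iff (algebraMap ℚ k).injective] at hint
    obtain ⟨z, hz⟩ := IsIntegrallyClosed.isIntegral_iff.1 hint
    have hn2 : (n : ℚ) + 1 ≠ 0 := by positivity
    rw [eq_div_iff hn2] at hz
    have hz' : z * (n + 1) = (n : ℤ) - 1 := by
      have : ((z * (n + 1) : ℤ) : ℚ) = ((n - 1 : ℤ) : ℚ) := by push_cast; simpa using hz
      exact_mod_cast this
    have hz0 : 0 < z := by
      by_contra hz0
      nlinarith
    nlinarith
  · exact h2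

end GaussSums

/-! ### Eigenvalues of the elements of a torus of order `q ^ 2 + 1` -/

section Eigenvalues

open Polynomial

variable {F K : Type*} [Field F] [Fintype F] [Field K] [Algebra F K]

/-- Extension of scalars followed by conjugation by `P`. -/
noncomputable def conjMap {ι : Type*} [Fintype ι] [DecidableEq ι] (P : GL ι K) :
    Matrix ι ι F →+* Matrix ι ι K where
  toFun g := (P⁻¹ : GL ι K).val * g.map (algebraMap F K) * P.val
  map_one' := by simp
  map_mul' a b := by
    rw [Matrix.map_mul]
    simp only [mul_assoc, Units.mul_inv_cancel_left]
  map_zero' := by simp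
  map_add' a b := by rw [Matrix.map_add _ (map_add _), mul_add, add_mul]

theorem conjMap_apply {ι : Type*} [Fintype ι] [DecidableEq ι] (P : GL ι K) (g : Matrix ι ι F) :
    conjMap P g = (P⁻¹ : GL ι K).val * g.map (algebraMap F K) * P.val := rfl

theorem conjMap_injective {ι : Type*} [Fintype ι] [DecidableEq ι] (P : GL ι K) :
    Function.Injective (conjMap (F := F) P) := by
  intro a b hab
  have h1 : a.map (algebraMap F K) = b.map (algebraMap F K) := by
    have := congrArg (fun X => P.val * X * (P⁻¹ : GL ι K).val) hab
    simpa [conjMap, mul_assoc] using this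
  exact Matrix.map_injective (algebraMap F K).injective h1

theorem conjMap_smul {ι : Type*} [Fintype ι] [DecidableEq ι] (P : GL ι K) (c : F)
    (g : Matrix ι ι F) : conjMap P (c • g) = algebraMap F K c • conjMap P g := by
  have : (c • g).map (algebraMap F K) = algebraMap F K c • g.map (algebraMap F K) := by
    ext; simp
  simp [conjMap, this]

theorem charpoly_conjMap {ι : Type*} [Fintype ι] [DecidableEq ι] (P : GL ι K)
    (g : Matrix ι ι F) : (conjMap P g).charpoly = g.charpoly.map (algebraMap F K) := by
  rw [← Matrix.charpoly_map, conjMap_apply, Matrix.coe_units_inv, Matrix.charpoly_units_conj']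

theorem exists_eig_of_mulVec {ι : Type*} [Fintype ι] [DecidableEq ι] {P : GL ι K}
    {g : Matrix ι ι F} {D : ι → K} (hD : conjMap P g = Matrix.diagonal D) {c : F} {v : ι → F}
    (hv : g.mulVec v = c • v) (hv0 : v ≠ 0) : ∃ i, D i = algebraMap F K c := by
  by_contra hcon
  push Not at hcon
  have h1 : (g - c • (1 : Matrix ι ι F)).mulVec v = 0 := by
    rw [Matrix.sub_mulVec, hv, Matrix.smul_mulVec, Matrix.one_mulVec, sub_self]
  have h2 : (g - c • (1 : Matrix ι ι F)).det = 0 := Matrix.exists_mulVec_eq_zero_iff.1 ⟨v, hv0, h1⟩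
  have h3 : (conjMap P (g - c • (1 : Matrix ι ι F))).det = 0 := by
    have e : (conjMap P (g - c • (1 : Matrix ι ι F))).det
        = ((g - c • (1 : Matrix ι ι F)).map (algebraMap F K)).det := by
      rw [conjMap_apply, Matrix.det_units_conj']
    rw [e, ← RingHom.mapMatrix_apply, ← RingHom.map_det, h2, map_zero]
  rw [map_sub, conjMap_smul, map_one, hD, ← Matrix.diagonal_one, ← Matrix.diagonal_smul,
    Matrix.diagonal_sub, Matrix.det_diagonal, Finset.prod_eq_zero_iff] at h3
  obtain ⟨i, -, hi⟩ := h3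
  exact hcon i (by simpa [sub_eq_zero] using hi)

theorem exists_eig_pow_card {ι : Type*} [Fintype ι] [DecidableEq ι] {P : GL ι K}
    {g : Matrix ι ι F} {D : ι → K} (hD : conjMap P g = Matrix.diagonal D) (i : ι) :
    ∃ j, D j = D i ^ Fintype.card F := by
  have key : ∀ x : K, aeval x g.charpoly = 0 ↔ ∃ j, D j = x := fun x => by
    rw [← eval_map_algebraMap, ← charpoly_conjMap P, hD, Matrix.charpoly_diagonal, eval_prod,
      Finset.prod_eq_zero_iff]
    simp only [Finset.mem_univ, true_and, eval_sub, eval_X, eval_C, sub_eq_zero]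
    exact exists_congr fun j => eq_comm
  rw [← key]
  have := Polynomial.aeval_algHom_apply (FiniteField.frobeniusAlgHom F K) (D i) g.charpoly
  rw [(key _).2 ⟨i, rfl⟩, map_zero] at this
  exact this

section orbit

variable {ι : Type*} [Fintype ι] {D : ι → K}

local notation "φ" => FiniteField.frobeniusAlgHom F K

variable (F) in
/-- If a set of at most four eigenvalues is stable under the Frobenius map `φ` and contains
`x ≠ ± 1` with `φ (φ x) = x⁻¹`, then it consists of the four distinct conjugates of `x`. -/
theorem eig_eq_conjugates (hι : Fintype.card ι = 4) (hφ : ∀ i, ∃ j, D j = φ (D i)) {i : ι}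
    (h1 : φ (φ (D i)) * D i = 1) (h2 : D i ^ 2 ≠ 1) :
    Function.Injective D ∧
      ∀ j, D j = D i ∨ D j = φ (D i) ∨ D j = φ (φ (D i)) ∨ D j = φ (φ (φ (D i))) := by
  set x := D i with hx
  have hinj : Function.Injective (φ) := (φ).toRingHom.injective
  have h02 : x ≠ φ (φ x) := fun h => h2 (by rw [sq]; nth_rw 1 [h]; exact h1)
  have h01 : x ≠ φ x := fun h => h02 (by rw [← h, ← h])
  have h4 : φ (φ (φ (φ x))) = x := by
    have := congrArg (fun z => φ (φ z)) h1
    simp only [map_mul, map_one] at this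
    refine mul_right_cancel₀ (left_ne_zero_of_mul_eq_one h1) ?_
    rw [this, mul_comm, h1]
  have h03 : x ≠ φ (φ (φ x)) := fun h => h01 (by
    have := congrArg (φ) h
    rw [h4] at this
    exact this.symm)
  obtain ⟨j1, hj1⟩ := hφ i
  obtain ⟨j2, hj2⟩ := hφ j1
  obtain ⟨j3, hj3⟩ := hφ j2
  rw [hj1] at hj2
  rw [hj2] at hj3
  let y : Fin 4 → ι := ![i, j1, j2, j3]
  have hy : Function.Injective (D ∘ y) := by
    have e : D ∘ y = ![x, φ x, φ (φ x), φ (φ (φ x))] := by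
      funext n; fin_cases n
      · rfl
      · exact hj1
      · exact hj2
      · exact hj3
    rw [e]
    intro a b hab
    have h12 := hinj.ne h01
    have h23 := hinj.ne h12
    have h13 := hinj.ne h02
    fin_cases a <;> fin_cases b <;> first | rfl | (exfalso; simp at hab; tauto)
  have hsurj : Function.Surjective y :=
    ((Fintype.bijective_iff_injective_and_card y).2
      ⟨hy.of_comp, by rw [hι, Fintype.card_fin]⟩).2
  refine ⟨fun a b hab => ?_, fun j => ?_⟩
  · obtain ⟨a, rfl⟩ := hsurj a
    obtain ⟨b, rfl⟩ := hsurj b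
    rw [hy hab]
  · obtain ⟨n, rfl⟩ := hsurj j
    fin_cases n
    · exact Or.inl rfl
    · exact Or.inr (Or.inl hj1)
    · exact Or.inr (Or.inr (Or.inl hj2))
    · exact Or.inr (Or.inr (Or.inr hj3))

end orbit

section torus

variable {A : Subgroup (Sp4 F)} {P : GL (Fin 2 ⊕ Fin 2) K}

/-- The eigenvalues of `g`, in the basis given by the columns of `P`, when that basis consists of
eigenvectors. -/
noncomputable def eig (P : GL (Fin 2 ⊕ Fin 2) K) (g : Sp4 F) (i : Fin 2 ⊕ Fin 2) : K :=
  conjMap P (g : Matrix _ _ F) i i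

theorem exists_two_mul_odd (hF : ringChar F ≠ 2) :
    ∃ m, Odd m ∧ Fintype.card F ^ 2 + 1 = 2 * m := by
  obtain ⟨r, hr⟩ := Nat.odd_iff.2 (FiniteField.odd_card_of_char_ne_two hF)
  exact ⟨2 * (r ^ 2 + r) + 1, ⟨_, rfl⟩, by rw [hr]; ring⟩

theorem conjMap_eq_diagonal (hA : ∀ g ∈ A, (conjMap P (g : Matrix _ _ F)).IsDiag) {g : Sp4 F}
    (hg : g ∈ A) : conjMap P (g : Matrix _ _ F)
      = Matrix.diagonal (eig P g) :=
  (hA g hg).diagonal_diag.symm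

theorem commute_of_isDiag (hA : ∀ g ∈ A, (conjMap P (g : Matrix _ _ F)).IsDiag) {g s : Sp4 F}
    (hg : g ∈ A) (hs : s ∈ A) : Commute (g : Matrix (Fin 2 ⊕ Fin 2) (Fin 2 ⊕ Fin 2) F) s := by
  apply conjMap_injective P
  rw [map_mul, map_mul, conjMap_eq_diagonal hA hg, conjMap_eq_diagonal hA hs,
    Matrix.diagonal_mul_diagonal, Matrix.diagonal_mul_diagonal]
  simp only [mul_comm]

theorem conjMap_pow_eq (hA : ∀ g ∈ A, (conjMap P (g : Matrix _ _ F)).IsDiag) {g : Sp4 F}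
    (hg : g ∈ A) (n : ℕ) : conjMap P ((g : Matrix _ _ F) ^ n)
      = Matrix.diagonal (fun i => eig P g i ^ n) := by
  rw [map_pow, conjMap_eq_diagonal hA hg, Matrix.diagonal_pow]
  rfl

theorem pow_card_eq_one (hcard : Nat.card A = Fintype.card F ^ 2 + 1) {g : Sp4 F} (hg : g ∈ A) :
    (g : Matrix (Fin 2 ⊕ Fin 2) (Fin 2 ⊕ Fin 2) F) ^ (Fintype.card F ^ 2 + 1) = 1 := by
  have h1 : (⟨g, hg⟩ : A) ^ Nat.card A = 1 := pow_card_eq_one'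
  rw [hcard] at h1
  exact congrArg (fun a : A => ((a : Sp4 F) : Matrix (Fin 2 ⊕ Fin 2) (Fin 2 ⊕ Fin 2) F)) h1

local notation "φ" => FiniteField.frobeniusAlgHom F K

/-- An element of `A` whose square is not `1` has four distinct eigenvalues, conjugate over `F`. -/
theorem exists_eig (hA : ∀ g ∈ A, (conjMap P (g : Matrix _ _ F)).IsDiag)
    (hcard : Nat.card A = Fintype.card F ^ 2 + 1) {g : Sp4 F} (hg : g ∈ A)
    (hg2 : (g : Matrix (Fin 2 ⊕ Fin 2) (Fin 2 ⊕ Fin 2) F) ^ 2 ≠ 1) :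
    ∃ x : K, x ^ (Fintype.card F ^ 2 + 1) = 1 ∧ φ (φ x) * x = 1 ∧ x ^ 2 ≠ 1 ∧
      Function.Injective (eig P g) ∧
      ∀ j, eig P g j = x ∨ eig P g j = φ x ∨
        eig P g j = φ (φ x) ∨
        eig P g j = φ (φ (φ x)) := by
  have h1 : ∃ i, eig P g i ^ 2 ≠ 1 := by
    by_contra hcon
    push Not at hcon
    apply hg2
    apply conjMap_injective P
    rw [conjMap_pow_eq hA hg, map_one]
    simp only [hcon]
    exact Matrix.diagonal_one
  obtain ⟨i, hi⟩ := h1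
  have h3 : eig P g i ^ (Fintype.card F ^ 2 + 1) = 1 := by
    have h2 := conjMap_pow_eq hA hg (Fintype.card F ^ 2 + 1)
    rw [pow_card_eq_one hcard hg, map_one, ← Matrix.diagonal_one] at h2
    exact (congrFun (Matrix.diagonal_injective h2) i).symm
  have h4 : φ (φ (eig P g i)) * eig P g i = 1 := by
    rw [← h3]
    simp only [FiniteField.coe_frobeniusAlgHom]
    rw [← pow_mul, ← sq, ← pow_succ]
  obtain ⟨h5, h6⟩ := eig_eq_conjugates F (D := fun i => eig P g i) (by simp)
    (fun i => exists_eig_pow_card (conjMap_eq_diagonal hA hg) i) h4 hi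
  exact ⟨_, h3, h4, hi, h5, h6⟩

theorem eig_sq_ne_one (hA : ∀ g ∈ A, (conjMap P (g : Matrix _ _ F)).IsDiag)
    (hcard : Nat.card A = Fintype.card F ^ 2 + 1) {g : Sp4 F} (hg : g ∈ A)
    (hg2 : (g : Matrix (Fin 2 ⊕ Fin 2) (Fin 2 ⊕ Fin 2) F) ^ 2 ≠ 1) (j : Fin 2 ⊕ Fin 2) :
    eig P g j ^ 2 ≠ 1 := by
  obtain ⟨x, -, -, hx, -, hD⟩ := exists_eig hA hcard hg hg2
  have hφ : ∀ y : K, y ^ 2 ≠ 1 → (φ y) ^ 2 ≠ 1 := fun y hy h => hy ((φ).toRingHom.injective (by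
    change φ (y ^ 2) = φ 1
    rw [map_pow, h, map_one]))
  rcases hD j with h | h | h | h <;> rw [h]
  exacts [hx, hφ _ hx, hφ _ (hφ _ hx), hφ _ (hφ _ (hφ _ hx))]

/-- An eigenvalue `x` of `g` has `x ^ m = ± 1`, and its conjugates, which are the other eigenvalues,
have the same `m`-th power. -/
theorem pow_eq_one_or_neg_one (hA : ∀ g ∈ A, (conjMap P (g : Matrix _ _ F)).IsDiag)
    (hcard : Nat.card A = Fintype.card F ^ 2 + 1) {m : ℕ} (hm : Fintype.card F ^ 2 + 1 = 2 * m)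
    {g : Sp4 F} (hg : g ∈ A)
    (hg2 : (g : Matrix (Fin 2 ⊕ Fin 2) (Fin 2 ⊕ Fin 2) F) ^ 2 ≠ 1) :
    (g : Matrix (Fin 2 ⊕ Fin 2) (Fin 2 ⊕ Fin 2) F) ^ m = 1 ∨
      (g : Matrix (Fin 2 ⊕ Fin 2) (Fin 2 ⊕ Fin 2) F) ^ m = -1 := by
  obtain ⟨x, hx, -, -, -, hD⟩ := exists_eig hA hcard hg hg2
  have h1 : x ^ m = 1 ∨ x ^ m = -1 := by
    rw [hm, mul_comm, pow_mul, sq] at hx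
    exact mul_self_eq_one_iff.1 hx
  have key : ∀ ε : F, x ^ m = algebraMap F K ε →
      (g : Matrix (Fin 2 ⊕ Fin 2) (Fin 2 ⊕ Fin 2) F) ^ m = ε • 1 := fun ε hε => by
    have hφ : ∀ y : K, y ^ m = algebraMap F K ε → (φ y) ^ m = algebraMap F K ε := fun y hy => by
      rw [← map_pow, hy, AlgHom.commutes]
    apply conjMap_injective P
    rw [conjMap_pow_eq hA hg, conjMap_smul, map_one, ← Matrix.diagonal_one, ← Matrix.diagonal_smul]
    congr 1
    funext j
    simp only [Pi.smul_apply, smul_eq_mul, mul_one]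
    rcases hD j with h | h | h | h <;> rw [h]
    exacts [hε, hφ _ hε, hφ _ (hφ _ hε), hφ _ (hφ _ (hφ _ hε))]
  rcases h1 with h | h
  · left; rw [key 1 (by rw [h, map_one]), one_smul]
  · right; rw [key (-1) (by rw [h, map_neg, map_one]), neg_one_smul]

/-- Otherwise `A` is a `2`-group, but `q ^ 2 + 1` is not a power of `2`: it is `2` modulo `4`,
and greater than `2`. -/
theorem exists_sq_ne_one (hF : ringChar F ≠ 2) (hcard : Nat.card A = Fintype.card F ^ 2 + 1) :
    ∃ g ∈ A, (g : Matrix (Fin 2 ⊕ Fin 2) (Fin 2 ⊕ Fin 2) F) ^ 2 ≠ 1 := by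
  by_contra hcon
  push Not at hcon
  have h1 : IsPGroup 2 A := fun a => ⟨1, by
    rw [pow_one]
    exact Subtype.ext (Subtype.ext (hcon a a.2))⟩
  obtain ⟨n, hn⟩ := IsPGroup.iff_card.1 h1
  obtain ⟨r, hr⟩ := Nat.odd_iff.2 (FiniteField.odd_card_of_char_ne_two hF)
  have hr0 : 0 < r := by
    have := Fintype.one_lt_card (α := F)
    omega
  rw [hcard, hr] at hn
  obtain _ | _ | n := n
  · rw [pow_zero] at hn
    have : 0 < (2 * r + 1) ^ 2 := by positivity
    omega
  · have : 0 < r ^ 2 := by positivity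
    rw [zero_add, pow_one] at hn
    nlinarith
  · have h2 : (2 * r + 1) ^ 2 + 1 = 4 * (r ^ 2 + r) + 2 := by ring
    have h3 : 2 ^ (n + 1 + 1) = 4 * 2 ^ n := by ring
    omega

/-- If `s² = 1` and `g` in `A` has `g² ≠ 1`, then `g ^ m` and `(g s) ^ m = g ^ m s` are both `± 1`,
where `q ^ 2 + 1 = 2 * m` with `m` odd. So `s = ± 1`. -/
theorem sq_ne_one (hF : ringChar F ≠ 2) (hA : ∀ g ∈ A, (conjMap P (g : Matrix _ _ F)).IsDiag)
    (hcard : Nat.card A = Fintype.card F ^ 2 + 1) {s : Sp4 F} (hs : s ∈ A)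
    (hs1 : (s : Matrix (Fin 2 ⊕ Fin 2) (Fin 2 ⊕ Fin 2) F) ≠ 1)
    (hs2 : (s : Matrix (Fin 2 ⊕ Fin 2) (Fin 2 ⊕ Fin 2) F) ≠ -1) :
    (s : Matrix (Fin 2 ⊕ Fin 2) (Fin 2 ⊕ Fin 2) F) ^ 2 ≠ 1 := by
  intro h
  obtain ⟨m, hmo, hm⟩ := exists_two_mul_odd hF
  obtain ⟨g, hg, hg2⟩ := exists_sq_ne_one hF hcard
  have hcomm := commute_of_isDiag hA hg hs
  have hgs : ((g * s : Sp4 F) : Matrix (Fin 2 ⊕ Fin 2) (Fin 2 ⊕ Fin 2) F) ^ 2 ≠ 1 := by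
    rw [Submonoid.coe_mul, hcomm.mul_pow, h, mul_one]
    exact hg2
  have h1 := pow_eq_one_or_neg_one hA hcard hm hg hg2
  have h2 := pow_eq_one_or_neg_one hA hcard hm (A.mul_mem hg hs) hgs
  have h3 : (s : Matrix (Fin 2 ⊕ Fin 2) (Fin 2 ⊕ Fin 2) F) ^ m = s := by
    obtain ⟨r, rfl⟩ := hmo
    rw [pow_succ, pow_mul, h, one_pow, one_mul]
  rw [Submonoid.coe_mul, hcomm.mul_pow, h3] at h2
  rcases h1 with h1 | h1 <;> rcases h2 with h2 | h2 <;> rw [h1] at h2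
  · exact hs1 (by simpa using h2)
  · exact hs2 (by simpa using h2)
  · exact hs2 (by rw [← h2]; simp)
  · exact hs1 (by simpa using h2)

/-- Elements of `A` other than `1` have no nonzero fixed vector. -/
theorem eq_one_of_mulVec_eq (hF : ringChar F ≠ 2)
    (hA : ∀ g ∈ A, (conjMap P (g : Matrix _ _ F)).IsDiag)
    (hcard : Nat.card A = Fintype.card F ^ 2 + 1) {s : Sp4 F} (hs : s ∈ A) {v : V F}
    (hv : (s : Matrix (Fin 2 ⊕ Fin 2) (Fin 2 ⊕ Fin 2) F).mulVec v = v) (hv0 : v ≠ 0) : s = 1 := by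
  by_contra hne
  by_cases h2 : (s : Matrix (Fin 2 ⊕ Fin 2) (Fin 2 ⊕ Fin 2) F) = -1
  · rw [h2, Matrix.neg_mulVec, Matrix.one_mulVec] at hv
    apply hv0
    have h3 : (2 : F) • v = 0 := by rw [two_smul]; nth_rw 1 [← hv]; simp
    exact (smul_eq_zero.1 h3).resolve_left (Ring.two_ne_zero hF)
  · have h3 := sq_ne_one hF hA hcard hs (fun h => hne (Subtype.ext h)) h2
    obtain ⟨i, hi⟩ := exists_eig_of_mulVec (conjMap_eq_diagonal hA hs) (c := 1)
      (by rw [hv, one_smul]) hv0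
    refine eig_sq_ne_one hA hcard hs h3 i ?_
    rw [hi, map_one, one_pow]

end torus
end Eigenvalues

section Eigenvalues

open Polynomial

variable {F E K : Type*} [Field F] [Fintype F] [Field E] [Algebra F E] [FiniteDimensional F E]
  [Field K] [IsAlgClosed K] [Algebra F K]

/-- The polynomial `X ^ |R| - X` splits over the finite field `R`. -/
theorem exists_map_eq_of_pow_card {R S : Type*} [Field R] [Fintype R] [Field S] (f : R →+* S)
    {y : S} (hy : y ^ Fintype.card R = y) : ∃ e, f e = y := by
  classical
  have h1 : ((X ^ Fintype.card R - X : R[X]).roots.map fun a => X - C a).prod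
      = X ^ Fintype.card R - X := by
    refine prod_multiset_X_sub_C_of_monic_of_roots_card_eq ?_ ?_
    · refine monic_X_pow_sub ?_
      rw [degree_X]
      exact_mod_cast Fintype.one_lt_card
    · rw [FiniteField.roots_X_pow_card_sub_X,
        FiniteField.X_pow_card_sub_X_natDegree_eq R Fintype.one_lt_card]
      rfl
  rw [FiniteField.roots_X_pow_card_sub_X, Finset.prod_map_val] at h1
  have h2 := congrArg (fun p => eval y (p.map f)) h1
  simp only [Polynomial.map_sub, Polynomial.map_pow, Polynomial.map_X, eval_sub, eval_pow, eval_X,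
    Polynomial.map_prod, Polynomial.map_C, eval_prod, eval_C, hy, sub_self] at h2
  obtain ⟨e, -, he⟩ := Finset.prod_eq_zero_iff.1 h2
  exact ⟨e, (sub_eq_zero.1 he).symm⟩

theorem exists_algebraMap_eq_of_conjE {z : E} (hz : conjE F E z = z) : ∃ a, algebraMap F E a = z :=
  exists_map_eq_of_pow_card _ (by simpa [conjE] using hz)

variable {A : Subgroup (Sp4 F)} {P : GL (Fin 2 ⊕ Fin 2) K}

local notation "φ" => FiniteField.frobeniusAlgHom F K

variable (E) in
/-- `s + s⁻¹` satisfies a quadratic equation with conjugate roots in `E` that are not in `F`. -/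
theorem exists_root_add_inv (hE : Module.finrank F E = 2)
    (hA : ∀ g ∈ A, (conjMap P (g : Matrix _ _ F)).IsDiag)
    (hcard : Nat.card A = Fintype.card F ^ 2 + 1) {s : Sp4 F} (hs : s ∈ A)
    (hs2 : (s : Matrix (Fin 2 ⊕ Fin 2) (Fin 2 ⊕ Fin 2) F) ^ 2 ≠ 1) :
    ∃ (τ : E) (a b : F), conjE F E τ ≠ τ ∧ algebraMap F E a = τ + conjE F E τ ∧
      algebraMap F E b = τ * conjE F E τ ∧
      (s.1 + (s⁻¹ : Sp4 F).1) * (s.1 + (s⁻¹ : Sp4 F).1)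
        - a • (s.1 + (s⁻¹ : Sp4 F).1) + b • 1 = 0 := by
  obtain ⟨x, -, h1, hx2, -, hD⟩ := exists_eig hA hcard hs hs2
  have := Module.finite_of_finite F (M := E)
  have := Fintype.ofFinite E
  let f : E →ₐ[F] K := IsAlgClosed.lift
  have hφinj : Function.Injective (φ) := (φ).toRingHom.injective
  have h2 : φ (φ (φ x)) * φ x = 1 := by rw [← map_mul, h1, map_one]
  have h4 : φ (φ (φ (φ x))) = x := by
    have := congrArg (fun z => φ (φ z)) h1
    simp only [map_mul, map_one] at this
    refine mul_right_cancel₀ (left_ne_zero_of_mul_eq_one h1) ?_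
    rw [this, mul_comm, h1]
  have h01 : φ x ≠ x := fun h => hx2 (by rw [sq]; nth_rw 1 [← h, ← h]; exact h1)
  obtain ⟨τ, hτ⟩ := exists_map_eq_of_pow_card (f : E →+* K) (y := x + φ (φ x)) (by
    have : φ (φ (x + φ (φ x))) = x + φ (φ x) := by
      rw [map_add, map_add, h4, add_comm]
    rw [Module.card_eq_pow_finrank (K := F), hE]
    simp only [FiniteField.coe_frobeniusAlgHom] at this ⊢
    rwa [← pow_mul, ← sq] at this)
  replace hτ : f τ = x + φ (φ x) := hτ
  have hfc : ∀ e, f (conjE F E e) = φ (f e) := fun e => by simp [conjE]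
  obtain ⟨a, ha⟩ : ∃ a, algebraMap F E a = τ + conjE F E τ :=
    exists_algebraMap_eq_of_conjE (by rw [map_add, conjE_conjE F E hE, add_comm])
  obtain ⟨b, hb⟩ : ∃ b, algebraMap F E b = τ * conjE F E τ :=
    exists_algebraMap_eq_of_conjE (by rw [map_mul, conjE_conjE F E hE, mul_comm])
  refine ⟨τ, a, b, fun h => ?_, ha, hb, ?_⟩
  · have h5 := congrArg f h
    rw [hfc, hτ, map_add] at h5
    -- `x` and `φ x` have the same sum with their inverses only if `φ x = x` or `φ x = x⁻¹`
    have h6 : (φ x - x) * (φ x - φ (φ x)) = 0 := by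
      linear_combination (φ x) * h5 - h2 + h1
    rcases mul_eq_zero.1 h6 with h7 | h7
    · exact h01 (sub_eq_zero.1 h7)
    · exact h01 (hφinj (sub_eq_zero.1 h7).symm)
  · have ha' : algebraMap F K a = f τ + φ (f τ) := by
      rw [← hfc, ← map_add, ← ha, AlgHom.commutes]
    have hb' : algebraMap F K b = f τ * φ (f τ) := by
      rw [← hfc, ← map_mul, ← hb, AlgHom.commutes]
    have hinv : ∀ j, eig P s j * eig P s⁻¹ j = 1 := fun j => by
      have h7 : conjMap P (s.1 * (s⁻¹ : Sp4 F).1) = 1 := by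
        rw [← Submonoid.coe_mul, mul_inv_cancel, Submonoid.coe_one, map_one]
      rw [map_mul, conjMap_eq_diagonal hA hs, conjMap_eq_diagonal hA (A.inv_mem hs),
        Matrix.diagonal_mul_diagonal, ← Matrix.diagonal_one] at h7
      exact congrFun (Matrix.diagonal_injective h7) j
    apply conjMap_injective P
    rw [map_add, map_sub, map_mul, map_add, conjMap_smul, conjMap_smul, map_one, map_zero, map_add,
      conjMap_eq_diagonal hA hs, conjMap_eq_diagonal hA (A.inv_mem hs), ← Matrix.diagonal_one,
      Matrix.diagonal_add, Matrix.diagonal_mul_diagonal, ← Matrix.diagonal_smul,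
      ← Matrix.diagonal_smul, Matrix.diagonal_sub, Matrix.diagonal_add, ← Matrix.diagonal_zero]
    congr 1
    funext j
    simp only [Pi.smul_apply, smul_eq_mul, ha', hb', hτ, map_add]
    have h8 : eig P s j + eig P s⁻¹ j = x + φ (φ x) ∨
        eig P s j + eig P s⁻¹ j = φ x + φ (φ (φ x)) := by
      have h9 : ∀ y, y * eig P s j = 1 → eig P s⁻¹ j = y := fun y hy => by
        refine mul_left_cancel₀ (right_ne_zero_of_mul_eq_one hy) ?_
        rw [hinv, mul_comm, hy]
      rcases hD j with h | h | h | h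
      · left; rw [h9 (φ (φ x)) (by rw [h, h1]), h]
      · right; rw [h9 (φ (φ (φ x))) (by rw [h, h2]), h]
      · left; rw [h9 x (by rw [h, mul_comm, h1]), h, add_comm]
      · right; rw [h9 (φ x) (by rw [h, mul_comm, h2]), h, add_comm]
    rcases h8 with h8 | h8 <;> rw [h8] <;> ring

end Eigenvalues

/-! ### Regular elements of a maximal torus -/

section Regular

variable {K : Type*} [Field K]

attribute [local instance] zariski

theorem isClosed_zeros (p : MvPolynomial ((Fin 2 ⊕ Fin 2) × (Fin 2 ⊕ Fin 2)) K) :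
    IsClosed {g : Sp4 K | p.eval (fun ij => (g : Matrix _ _ K) ij.1 ij.2) = 0} := by
  refine isClosed_induced_iff.2 ⟨_, PrimeSpectrum.isClosed_zeroLocus {p}, ?_⟩
  ext g
  simp [MvPolynomial.pointToPoint, MvPolynomial.aeval_eq_eval]

theorem continuous_mul_left_zariski (a : Sp4 K) : Continuous (fun g : Sp4 K => a * g) := by
  refine continuous_induced_rng.2 ?_
  let α : MvPolynomial ((Fin 2 ⊕ Fin 2) × (Fin 2 ⊕ Fin 2)) K →ₐ[K]
      MvPolynomial ((Fin 2 ⊕ Fin 2) × (Fin 2 ⊕ Fin 2)) K :=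
    MvPolynomial.aeval fun ij => ∑ l, MvPolynomial.C ((a : Matrix _ _ K) ij.1 l)
      * MvPolynomial.X (l, ij.2)
  have : ((fun g : Sp4 K => MvPolynomial.pointToPoint (k := K)
      (fun ij : (Fin 2 ⊕ Fin 2) × (Fin 2 ⊕ Fin 2) => (g : Matrix _ _ K) ij.1 ij.2))
        ∘ fun g : Sp4 K => a * g)
      = PrimeSpectrum.comap α.toRingHom ∘ fun g : Sp4 K => MvPolynomial.pointToPoint (k := K)
        (fun ij : (Fin 2 ⊕ Fin 2) × (Fin 2 ⊕ Fin 2) => (g : Matrix _ _ K) ij.1 ij.2) := by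
    funext g
    ext p
    simp only [Function.comp_apply, MvPolynomial.pointToPoint, PrimeSpectrum.comap_asIdeal,
      Ideal.mem_comap, MvPolynomial.mem_vanishingIdeal_singleton_iff]
    have h : ((MvPolynomial.aeval
          (fun ij : (Fin 2 ⊕ Fin 2) × (Fin 2 ⊕ Fin 2) => (g : Matrix _ _ K) ij.1 ij.2)).comp α :
            MvPolynomial _ K →ₐ[K] K)
        = MvPolynomial.aeval (fun ij => ((a * g : Sp4 K) : Matrix _ _ K) ij.1 ij.2) := by
      ext ij
      simp [α, Matrix.mul_apply]
    rw [← h]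
    rfl
  rw [this]
  exact (PrimeSpectrum.continuous_comap _).comp continuous_induced_dom

theorem isClosed_centralizer (g : Sp4 K) :
    IsClosed ((Subgroup.centralizer {g} : Subgroup (Sp4 K)) : Set (Sp4 K)) := by
  have : ((Subgroup.centralizer {g} : Subgroup (Sp4 K)) : Set (Sp4 K)) = ⋂ i, ⋂ j, {h : Sp4 K |
      (∑ l, (MvPolynomial.C ((g : Matrix _ _ K) i l) * MvPolynomial.X (l, j)
        - MvPolynomial.X (i, l) * MvPolynomial.C ((g : Matrix _ _ K) l j))).eval
        (fun ij : (Fin 2 ⊕ Fin 2) × (Fin 2 ⊕ Fin 2) => (h : Matrix _ _ K) ij.1 ij.2) = 0} := by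
    ext h
    simp only [SetLike.mem_coe, Subgroup.mem_centralizer_singleton_iff, Set.mem_iInter,
      Set.mem_ofPred_eq, map_sum, map_sub, map_mul, MvPolynomial.eval_C, MvPolynomial.eval_X,
      Finset.sum_sub_distrib, sub_eq_zero]
    rw [Subtype.ext_iff, ← Matrix.ext_iff]
    simp only [Submonoid.coe_mul, Matrix.mul_apply]
    exact forall_congr' fun i => forall_congr' fun j => eq_comm
  rw [this]
  exact isClosed_iInter fun i => isClosed_iInter fun j => isClosed_zeros _

/-- The identity component of a subgroup, in the Zariski topology. -/
def identityComponent (C : Subgroup (Sp4 K)) : Subgroup (Sp4 K) :=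
  have key : ∀ {a b : Sp4 K}, a ∈ connectedComponentIn (C : Set (Sp4 K)) 1 →
      b ∈ connectedComponentIn (C : Set (Sp4 K)) 1 →
      a⁻¹ * b ∈ connectedComponentIn (C : Set (Sp4 K)) 1 := fun {a b} ha hb => by
    have haC : a ∈ C := connectedComponentIn_subset _ _ ha
    refine IsPreconnected.subset_connectedComponentIn
      (isPreconnected_connectedComponentIn.image _ (continuous_mul_left_zariski a⁻¹).continuousOn)
      ⟨a, ha, inv_mul_cancel a⟩ ?_ ⟨b, hb, rfl⟩
    rintro _ ⟨c, hc, rfl⟩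
    exact C.mul_mem (C.inv_mem haC) (connectedComponentIn_subset _ _ hc)
  have one : (1 : Sp4 K) ∈ connectedComponentIn (C : Set (Sp4 K)) 1 :=
    mem_connectedComponentIn C.one_mem
  { carrier := connectedComponentIn (C : Set (Sp4 K)) 1
    one_mem' := one
    inv_mem' := fun {a} ha => by simpa using key ha one
    mul_mem' := fun {a b} ha hb => by simpa using key (by simpa using key ha one : a⁻¹ ∈ _) hb }

/-- The centralizer of an element with distinct eigenvalues is diagonalizable, so its identity
component is a torus; it contains every torus through that element. -/
theorem isRegularSemisimple_of_injective {T : Subgroup (Sp4 K)} (hT : IsMaximalTorus T)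
    {g : Sp4 K} (hg : g ∈ T) {P : GL (Fin 2 ⊕ Fin 2) K} {D : Fin 2 ⊕ Fin 2 → K}
    (hP : ∀ h ∈ T, ((P⁻¹ : GL (Fin 2 ⊕ Fin 2) K).val * (h : Matrix _ _ K) * P.val).IsDiag)
    (hD : (P⁻¹ : GL (Fin 2 ⊕ Fin 2) K).val * (g : Matrix _ _ K) * P.val = Matrix.diagonal D)
    (hinj : Function.Injective D) : IsRegularSemisimple g := by
  set C : Subgroup (Sp4 K) := Subgroup.centralizer {g} with hC
  have hconj : ∀ a b : Matrix (Fin 2 ⊕ Fin 2) (Fin 2 ⊕ Fin 2) K,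
      (P⁻¹ : GL (Fin 2 ⊕ Fin 2) K).val * (a * b) * P.val
        = ((P⁻¹ : GL (Fin 2 ⊕ Fin 2) K).val * a * P.val)
          * ((P⁻¹ : GL (Fin 2 ⊕ Fin 2) K).val * b * P.val) := fun a b => by
    simp only [mul_assoc, Units.mul_inv_cancel_left]
  have hdiag : ∀ h ∈ C, ((P⁻¹ : GL (Fin 2 ⊕ Fin 2) K).val * (h : Matrix _ _ K) * P.val).IsDiag := by
    intro h hh i j hij
    have h1 : h.1 * g.1 = g.1 * h.1 :=
      congrArg Subtype.val (Subgroup.mem_centralizer_singleton_iff.1 hh)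
    have h2 := congrArg (fun X => ((P⁻¹ : GL (Fin 2 ⊕ Fin 2) K).val * X * P.val) i j) h1
    simp only [hconj, hD, Matrix.mul_diagonal, Matrix.diagonal_mul] at h2
    have h3 : D i ≠ D j := hinj.ne hij
    have h4 : (D i - D j)
        * ((P⁻¹ : GL (Fin 2 ⊕ Fin 2) K).val * h.1 * P.val : Matrix _ _ K) i j = 0 := by
      linear_combination -h2
    exact (mul_eq_zero.1 h4).resolve_left (sub_ne_zero.2 h3)
  have hTC : (T : Set (Sp4 K)) ⊆ C := by
    intro h hh
    refine Subgroup.mem_centralizer_singleton_iff.2 (Subtype.ext ?_)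
    have h1 : (P⁻¹ : GL (Fin 2 ⊕ Fin 2) K).val * (h.1 * g.1) * P.val
        = (P⁻¹ : GL (Fin 2 ⊕ Fin 2) K).val * (g.1 * h.1) * P.val := by
      rw [hconj, hconj, hD, ← (hP h hh).diagonal_diag, Matrix.diagonal_mul_diagonal,
        Matrix.diagonal_mul_diagonal]
      simp only [mul_comm]
    have h2 := congrArg (fun X => P.val * X * (P⁻¹ : GL (Fin 2 ⊕ Fin 2) K).val) h1
    simpa [mul_assoc] using h2
  have hle : T ≤ identityComponent C := fun h hh =>
    hT.prop.isConnected.isPreconnected.subset_connectedComponentIn T.one_mem hTC hh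
  have htorus : IsTorus (identityComponent C) :=
    { isClosed := by
        refine isClosed_of_closure_subset ?_
        exact IsPreconnected.subset_connectedComponentIn
          isPreconnected_connectedComponentIn.closure
          (subset_closure (identityComponent C).one_mem)
          (closure_minimal (connectedComponentIn_subset _ _) (isClosed_centralizer g))
      isConnected := isConnected_connectedComponentIn_iff.2 C.one_mem
      diagonalizable := ⟨P, fun h hh => hdiag h (connectedComponentIn_subset _ _ hh)⟩ }
  refine ⟨⟨P, hP g hg⟩, T, hT, ?_⟩
  exact congrArg (fun T : Subgroup (Sp4 K) => (T : Set (Sp4 K)))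
    (le_antisymm (hT.le_of_ge htorus hle) hle)

end Regular

/-! ### The orthogonal group of the quadratic extension -/

section Orthogonal

variable {F E : Type*} [Field F] [Fintype F] [Field E] [Algebra F E] [FiniteDimensional F E]

theorem two_ne_zero_of_algebra (hF : ringChar F ≠ 2) : (2 : E) ≠ 0 := by
  have := (algebraMap F E).injective.ne (Ring.two_ne_zero hF)
  rwa [map_ofNat, map_zero] at this

theorem formE_mul_eq (hF : ringChar F ≠ 2) (hE : Module.finrank F E = 2) {x y z w : E}
    (h : formE F E x y = formE F E z w) :
    x * conjE F E y + conjE F E x * y = z * conjE F E w + conjE F E z * w := by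
  have h1 := congrArg (algebraMap F E) h
  rw [algebraMap_formE F E hE, algebraMap_formE F E hE] at h1
  have h2 : (2 : E)⁻¹ ≠ 0 := inv_ne_zero (two_ne_zero_of_algebra (F := F) hF)
  exact mul_left_cancel₀ h2 h1

theorem exists_conjE_ne (hE : Module.finrank F E = 2) : ∃ x, conjE F E x ≠ x := by
  by_contra hcon
  push Not at hcon
  have h1 : Function.Surjective (Algebra.linearMap F E) :=
    fun x => exists_algebraMap_eq_of_conjE (hcon x)
  have h2 := LinearMap.finrank_le_finrank_of_surjective h1
  rw [hE, Module.finrank_self] at h2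
  omega

/-- An isometry of `E` is `x ↦ u x` or `x ↦ u x ^ q` with `u` of norm one. -/
theorem isometry_eq (hF : ringChar F ≠ 2) (hE : Module.finrank F E = 2) (t : OE F E) :
    ∃ u : E, u * conjE F E u = 1 ∧
      ((∀ x, (t : E ≃ₗ[F] E) x = u * x) ∨ ∀ x, (t : E ≃ₗ[F] E) x = u * conjE F E x) := by
  set c := conjE F E
  have h2 : (2 : E) ≠ 0 := two_ne_zero_of_algebra (F := F) hF
  set u := (t : E ≃ₗ[F] E) 1 with hu
  have hN : ∀ x, (t : E ≃ₗ[F] E) x * c ((t : E ≃ₗ[F] E) x) = x * c x := fun x => by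
    have := formE_mul_eq hF hE (t.2 x x)
    refine mul_left_cancel₀ h2 ?_
    linear_combination this
  have hT : ∀ x, (t : E ≃ₗ[F] E) x * c u + c ((t : E ≃ₗ[F] E) x) * u = x + c x := fun x => by
    have := formE_mul_eq hF hE (t.2 x 1)
    simpa using this
  have huu : u * c u = 1 := by simpa using hN 1
  -- `c u * t x` has the same trace and norm as `x`
  have h3 : ∀ x, c u * (t : E ≃ₗ[F] E) x = x ∨ c u * (t : E ≃ₗ[F] E) x = c x := fun x => by
    have : (c u * (t : E ≃ₗ[F] E) x - x) * (c u * (t : E ≃ₗ[F] E) x - c x) = 0 := by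
      linear_combination c u * (t : E ≃ₗ[F] E) x * hT x
        - c ((t : E ≃ₗ[F] E) x) * (t : E ≃ₗ[F] E) x * huu - hN x
    rcases mul_eq_zero.1 this with h | h
    · exact Or.inl (sub_eq_zero.1 h)
    · exact Or.inr (sub_eq_zero.1 h)
  have h4 : ∀ x y, c u * (t : E ≃ₗ[F] E) x = y → (t : E ≃ₗ[F] E) x = u * y := fun x y h => by
    rw [← h, ← mul_assoc, huu, one_mul]
  refine ⟨u, huu, ?_⟩
  by_contra hcon
  push Not at hcon
  obtain ⟨⟨x, hx⟩, ⟨y, hy⟩⟩ := hcon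
  have hx1 := (h3 x).resolve_left fun h => hx (h4 _ _ h)
  have hy1 := (h3 y).resolve_right fun h => hy (h4 _ _ h)
  have hxy := h3 (x + y)
  rw [map_add, map_add, mul_add, hx1, hy1] at hxy
  rcases hxy with h | h
  · exact hx (h4 _ _ (by rw [hx1]; exact add_right_cancel h))
  · exact hy (h4 _ _ (by rw [hy1]; exact add_left_cancel h))

/-- The semilinear isometries are reflections. -/
theorem exists_basis_reflection (hF : ringChar F ≠ 2) (hE : Module.finrank F E = 2)
    {t : E ≃ₗ[F] E} {u : E} (hu : u * conjE F E u = 1) (ht : ∀ x, t x = u * conjE F E x) :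
    ∃ b : Module.Basis (Fin 2) F E, t (b 0) = b 0 ∧ t (b 1) = -b 1 := by
  have h2 : (2 : F) ≠ 0 := Ring.two_ne_zero hF
  have htt : ∀ x, t (t x) = x := fun x => by
    rw [ht, ht, map_mul, conjE_conjE F E hE, ← mul_assoc, hu, one_mul]
  obtain ⟨z, hz⟩ := exists_conjE_ne (F := F) (E := E) hE
  have h1 : ∃ x, x - t x ≠ 0 := by
    by_contra hcon
    push Not at hcon
    have hu1 : u = 1 := by
      have := hcon 1
      rw [ht, map_one, mul_one, sub_eq_zero] at this
      exact this.symm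
    have := hcon z
    rw [ht, hu1, one_mul, sub_eq_zero] at this
    exact hz this.symm
  have h3 : ∃ x, x + t x ≠ 0 := by
    by_contra hcon
    push Not at hcon
    have hu1 : u = -1 := by
      have := hcon 1
      rw [ht, map_one, mul_one] at this
      linear_combination this
    have := hcon z
    rw [ht, hu1] at this
    exact hz (by linear_combination -this)
  obtain ⟨x, hx⟩ := h1
  obtain ⟨y, hy⟩ := h3
  have e1 : t (x - t x) = -(x - t x) := by rw [map_sub, htt]; ring
  have e0 : t (y + t y) = y + t y := by rw [map_add, htt]; ring
  have hli : LinearIndependent F ![y + t y, x - t x] := by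
    rw [LinearIndependent.pair_iff]
    intro α β h
    have h' := congrArg t h
    rw [map_add, map_smul, map_smul, e0, e1, map_zero] at h'
    constructor
    · have : (2 * α) • (y + t y) = 0 := by
        have := congrArg₂ (· + ·) h h'
        simp only [smul_neg, add_zero] at this
        rw [two_mul, add_smul]
        linear_combination (exp := 1) this
      simpa [hy, h2, -smul_add] using this
    · have : (2 * β) • (x - t x) = 0 := by
        have := congrArg₂ (· - ·) h h'
        simp only [smul_neg, sub_zero] at this
        rw [two_mul, add_smul]
        linear_combination (exp := 1) this
      simpa [hx, h2] using this
  refine ⟨basisOfLinearIndependentOfCardEqFinrank hli (by rw [hE, Fintype.card_fin]), ?_, ?_⟩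
  · simpa using e0
  · simpa using e1

theorem det_reflection {t : E ≃ₗ[F] E} (b : Module.Basis (Fin 2) F E) (h0 : t (b 0) = b 0)
    (h1 : t (b 1) = -b 1) : LinearMap.det (t : E →ₗ[F] E) = -1 := by
  rw [← LinearMap.det_toMatrix b, Matrix.det_fin_two]
  simp [LinearMap.toMatrix_apply, h0, h1]

theorem det_mul_of_norm_one (hE : Module.finrank F E = 2) {t : E ≃ₗ[F] E} {u : E}
    (hu : u * conjE F E u = 1) (ht : ∀ x, t x = u * x) : LinearMap.det (t : E →ₗ[F] E) = 1 := by
  have : (t : E →ₗ[F] E) = Algebra.lmul F E u := by ext x; exact ht x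
  rw [this, ← Algebra.norm_apply]
  have := Module.finite_of_finite F (M := E)
  apply (algebraMap F E).injective
  rw [FiniteField.algebraMap_norm_eq_prod_pow, hE, Finset.prod_range_succ, Finset.prod_range_one,
    map_one, ← hu]
  simp [conjE]

theorem exists_mul_of_det_eq_one (hF : ringChar F ≠ 2) (hE : Module.finrank F E = 2) {t : OE F E}
    (ht : LinearMap.det ((t : E ≃ₗ[F] E) : E →ₗ[F] E) = 1) :
    ∃ u : E, u * conjE F E u = 1 ∧ ∀ x, (t : E ≃ₗ[F] E) x = u * x := by
  obtain ⟨u, hu, h | h⟩ := isometry_eq hF hE t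
  · exact ⟨u, hu, h⟩
  · obtain ⟨b, h0, h1⟩ := exists_basis_reflection hF hE hu h
    rw [det_reflection b h0 h1] at ht
    exact absurd ht (Ring.neg_one_ne_one_of_char_ne_two hF)

theorem exists_basis_of_det_ne_one (hF : ringChar F ≠ 2) (hE : Module.finrank F E = 2) {t : OE F E}
    (ht : LinearMap.det ((t : E ≃ₗ[F] E) : E →ₗ[F] E) ≠ 1) :
    ∃ b : Module.Basis (Fin 2) F E,
      (t : E ≃ₗ[F] E) (b 0) = b 0 ∧ (t : E ≃ₗ[F] E) (b 1) = -b 1 := by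
  obtain ⟨u, hu, h | h⟩ := isometry_eq hF hE t
  · exact absurd (det_mul_of_norm_one hE hu h) ht
  · exact exists_basis_reflection hF hE hu h

/-- Elements of norm one have order dividing `q + 1`, hence dividing `(q ^ 2 - 1) / 2`, so they are
squares in `E`. -/
theorem exists_sq_eq (hF : ringChar F ≠ 2) (hE : Module.finrank F E = 2) {y : E}
    (hy : y * conjE F E y = 1) : ∃ w, w * w = y := by
  have := Module.finite_of_finite F (M := E)
  have := Fintype.ofFinite E
  have hE2 : ringChar E ≠ 2 := by
    rwa [← Algebra.ringChar_eq F E]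
  have hy0 : y ≠ 0 := left_ne_zero_of_mul_eq_one hy
  have : IsSquare y := by
    rw [FiniteField.isSquare_iff hE2 hy0, Module.card_eq_pow_finrank (K := F), hE]
    obtain ⟨r, hr⟩ := Nat.odd_iff.2 (FiniteField.odd_card_of_char_ne_two hF)
    have e : Fintype.card F ^ 2 / 2 = (Fintype.card F + 1) * r := by
      rw [hr]
      have : (2 * r + 1) ^ 2 = 2 * ((2 * r + 1 + 1) * r) + 1 := by ring
      omega
    have h1 : y ^ (Fintype.card F + 1) = 1 := by
      rw [pow_succ, mul_comm, ← hy]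
      simp [conjE]
    rw [e, pow_mul, h1, one_pow]
  obtain ⟨w, hw⟩ := this
  exact ⟨w, hw.symm⟩

end Orthogonal

/-! ### The character at `s ⊗ t` with `t` a rotation -/

section Rotation

variable {F E : Type*} [Field F] [Fintype F] [Field E] [Algebra F E] [FiniteDimensional F E]

variable (F) in
/-- The action of `E` on `V ⊗ E` through the second factor. -/
noncomputable def mulE : E →+* Module.End F (V F ⊗[F] E) where
  toFun x := (LinearMap.mulLeft F x).lTensor (V F)
  map_one' := by ext; simp
  map_mul' x y := by ext; simp
  map_zero' := by ext; simp
  map_add' x y := by ext; simp [add_mul, TensorProduct.tmul_add]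

theorem mulE_tmul (x : E) (v : V F) (e : E) : mulE F x (v ⊗ₜ[F] e) = v ⊗ₜ (x * e) := rfl

theorem mulE_algebraMap (a : F) :
    mulE F (algebraMap F E a) = a • (1 : Module.End F (V F ⊗[F] E)) := by
  refine TensorProduct.ext' fun v e => ?_
  rw [mulE_tmul, ← Algebra.smul_def]
  simp

variable (E) in
/-- The action of the endomorphisms of `V` on `V ⊗ E` through the first factor. -/
noncomputable def actV : Module.End F (V F) →+* Module.End F (V F ⊗[F] E) where
  toFun X := X.rTensor E
  map_one' := by ext; simp
  map_mul' X Y := by ext; simp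
  map_zero' := by ext; simp
  map_add' X Y := by ext; simp

theorem actV_tmul (X : Module.End F (V F)) (v : V F) (e : E) :
    actV E X (v ⊗ₜ[F] e) = X v ⊗ₜ e := rfl

theorem actV_smul (a : F) (X : Module.End F (V F)) : actV E (a • X) = a • actV E X := by
  refine TensorProduct.ext' fun v e => ?_
  simp [actV_tmul, TensorProduct.smul_tmul']

theorem actV_comm (X : Module.End F (V F)) (x : E) : Commute (actV E X) (mulE F x) := by
  refine TensorProduct.ext' fun v e => ?_
  simp [actV_tmul, mulE_tmul]

theorem formVE_actV {X Y : Module.End F (V F)} (hXY : ∀ v w, formV F (X v) w = formV F v (Y w))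
    (x y : V F ⊗[F] E) : formVE F E (actV E X x) y = formVE F E x (actV E Y y) := by
  induction x with
  | zero => simp
  | add a b ha hb => simp only [map_add, LinearMap.add_apply, ha, hb]
  | tmul v e =>
    induction y with
    | zero => simp
    | add a b ha hb => simp only [map_add, ha, hb]
    | tmul w f => rw [actV_tmul, actV_tmul, formVE_tmul, formVE_tmul, hXY]

theorem formE_mul_left (hE : Module.finrank F E = 2) (z x y : E) :
    formE F E (z * x) y = formE F E x (conjE F E z * y) := by
  rw [formE_apply, formE_apply]
  congr 2
  have : (conjE F E z * y) ^ Fintype.card F = conjE F E (conjE F E z) * y ^ Fintype.card F := by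
    rw [mul_pow]; rfl
  rw [this, conjE_conjE F E hE]
  ring

theorem formVE_mulE (hE : Module.finrank F E = 2) (z : E) (x y : V F ⊗[F] E) :
    formVE F E (mulE F z x) y = formVE F E x (mulE F (conjE F E z) y) := by
  induction x with
  | zero => simp
  | add a b ha hb => simp only [map_add, LinearMap.add_apply, ha, hb]
  | tmul v e =>
    induction y with
    | zero => simp
    | add a b ha hb => simp only [map_add, ha, hb]
    | tmul w f => rw [mulE_tmul, mulE_tmul, formVE_tmul, formVE_tmul, formE_mul_left hE]

theorem mulE_injective {z : E} (hz : z ≠ 0) {x : V F ⊗[F] E} (h : mulE F z x = 0) : x = 0 := by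
  have h1 := congrArg (mulE F z⁻¹) h
  rwa [map_zero, ← Module.End.mul_apply, ← map_mul, inv_mul_cancel₀ hz, map_one,
    Module.End.one_apply] at h1

/-- The subspace of `V ⊗ E` on which the endomorphism `X` of `V` acts as the scalar `τ` of `E`. -/
noncomputable def eigVE (X : Module.End F (V F)) (τ : E) : Submodule F (V F ⊗[F] E) :=
  LinearMap.ker (actV E X - mulE F τ)

theorem mem_eigVE {X : Module.End F (V F)} {τ : E} {x : V F ⊗[F] E} :
    x ∈ eigVE X τ ↔ actV E X x = mulE F τ x := by
  rw [eigVE, LinearMap.mem_ker, LinearMap.sub_apply, sub_eq_zero]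

theorem mem_eigVE_of_commute {X : Module.End F (V F)} {τ : E} {x : V F ⊗[F] E}
    {T : Module.End F (V F ⊗[F] E)} (h1 : Commute T (actV E X)) (h2 : Commute T (mulE F τ))
    (hx : x ∈ eigVE X τ) : T x ∈ eigVE X τ := by
  rw [mem_eigVE] at hx ⊢
  rw [← Module.End.mul_apply, ← h1.eq, Module.End.mul_apply, hx, ← Module.End.mul_apply, h2.eq,
    Module.End.mul_apply]

theorem mulE_comm (x y : E) : Commute (mulE F x) (mulE F y) := by
  rw [Commute, SemiconjBy, ← map_mul, ← map_mul, mul_comm]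

/-- `X` is self-adjoint while the adjoint of the scalar `τ` is its conjugate, so eigenspaces for
scalars that are not self-conjugate are isotropic. -/
theorem eigVE_isotropic (hE : Module.finrank F E = 2) {X : Module.End F (V F)}
    (hX : ∀ v w, formV F (X v) w = formV F v (X w)) {τ : E} (hτ : conjE F E τ ≠ τ)
    {x y : V F ⊗[F] E} (hx : x ∈ eigVE X τ) (hy : y ∈ eigVE X τ) : formVE F E x y = 0 := by
  have hz : τ - conjE F E τ ≠ 0 := sub_ne_zero.2 hτ.symm
  have key : ∀ x ∈ eigVE X τ, formVE F E (mulE F (τ - conjE F E τ) x) y = 0 := fun x hx => by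
    rw [mem_eigVE] at hx hy
    have h1 := formVE_actV hX x y
    rw [hx, hy] at h1
    have h2 := formVE_mulE hE (conjE F E τ) x y
    rw [conjE_conjE F E hE, ← h1] at h2
    rw [map_sub, LinearMap.sub_apply, map_sub, LinearMap.sub_apply, h2, sub_self]
  have h3 := key _ (mem_eigVE_of_commute (T := mulE F (τ - conjE F E τ)⁻¹)
    (actV_comm X _).symm (mulE_comm _ _) hx)
  rwa [← Module.End.mul_apply, ← map_mul, mul_inv_cancel₀ hz, map_one, Module.End.one_apply] at h3

theorem sub_mul_sub_of_commute {R : Type*} [Ring R] {S T T' : R} (h : Commute S T') :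
    (S - T) * (S - T') = S * S - (T + T') * S + T * T' := by
  rw [sub_mul, mul_sub, mul_sub, h.eq, add_mul]
  abel

/-- If the self-adjoint `X` satisfies a quadratic equation with conjugate roots in `E` outside `F`,
its two eigenspaces in `V ⊗ E` are complementary Lagrangians. -/
theorem polarization_eigVE (hF : ringChar F ≠ 2) (hE : Module.finrank F E = 2)
    {X : Module.End F (V F)} (hX : ∀ v w, formV F (X v) w = formV F v (X w)) {τ : E}
    (hτ : conjE F E τ ≠ τ) {a b : F} (ha : algebraMap F E a = τ + conjE F E τ)
    (hb : algebraMap F E b = τ * conjE F E τ) (hq : X * X - a • X + b • 1 = 0) :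
    IsPolarization (formVE F E) (eigVE X τ) (eigVE X (conjE F E τ)) where
  alt := (polarization F E hF hE).alt
  nondeg := (polarization F E hF hE).nondeg
  isotropic_left _ hx _ hy := eigVE_isotropic hE hX hτ hx hy
  isotropic_right _ hx _ hy :=
    eigVE_isotropic hE hX (by rw [conjE_conjE F E hE]; exact hτ.symm) hx hy
  isCompl := by
    have hz : τ - conjE F E τ ≠ 0 := sub_ne_zero.2 hτ.symm
    have h1 : (actV E X - mulE F τ) * (actV E X - mulE F (conjE F E τ)) = 0 := by
      have h2 := congrArg (actV E) hq
      rw [map_add, map_sub, map_mul, actV_smul, actV_smul, map_one, ← mulE_algebraMap, hb,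
        map_zero] at h2
      have h3 : a • actV E X = (mulE F τ + mulE F (conjE F E τ)) * actV E X := by
        rw [← map_add, ← ha, mulE_algebraMap, smul_mul_assoc, one_mul]
      rw [h3, map_mul] at h2
      exact (sub_mul_sub_of_commute (R := Module.End F (V F ⊗[F] E)) (actV_comm X _)).trans h2
    have h1' : (actV E X - mulE F (conjE F E τ)) * (actV E X - mulE F τ) = 0 := by
      refine (sub_mul_sub_of_commute (R := Module.End F (V F ⊗[F] E)) (actV_comm X _)).trans ?_
      rw [add_comm (mulE F (conjE F E τ)), (mulE_comm (conjE F E τ) τ).eq]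
      exact (sub_mul_sub_of_commute (R := Module.End F (V F ⊗[F] E)) (actV_comm X _)).symm.trans h1
    refine ⟨Submodule.disjoint_def.2 fun x hx hy => ?_, ?_⟩
    · rw [mem_eigVE] at hx hy
      refine mulE_injective hz ?_
      rw [map_sub, LinearMap.sub_apply, ← hx, ← hy, sub_self]
    · rw [codisjoint_iff, eq_top_iff]
      rintro x -
      have hx : x = mulE F (τ - conjE F E τ)⁻¹ ((actV E X - mulE F (conjE F E τ)) x)
          + mulE F (τ - conjE F E τ)⁻¹ (-(actV E X - mulE F τ) x) := by
        have h3 : (actV E X - mulE F (conjE F E τ)) x + -(actV E X - mulE F τ) x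
            = mulE F (τ - conjE F E τ) x := by
          rw [map_sub]
          simp only [LinearMap.sub_apply]
          abel
        rw [← map_add, h3, ← Module.End.mul_apply, ← map_mul, inv_mul_cancel₀ hz, map_one,
          Module.End.one_apply]
      rw [hx]
      refine Submodule.add_mem_sup ?_ ?_
      · refine mem_eigVE_of_commute (actV_comm X _).symm (mulE_comm _ _) ?_
        exact LinearMap.congr_fun h1 x
      · refine mem_eigVE_of_commute (actV_comm X _).symm (mulE_comm _ _) (Submodule.neg_mem _ ?_)
        exact LinearMap.congr_fun h1' x

variable {K : Type*} [Field K] [IsAlgClosed K] [Algebra F K] {A : Subgroup (Sp4 F)}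
  {P : GL (Fin 2 ⊕ Fin 2) K} {k : Type*} [Field k] [CharZero k]

/-- Over `E`, the eigenvalues of `s` form two pairs of inverses, interchanged by conjugation. The
two corresponding subspaces form a polarization stable under `s ⊗ t`; there `s ⊗ t` is a square and
has no fixed vector. -/
theorem eta_eq_one (hF : ringChar F ≠ 2) (hE : Module.finrank F E = 2) {ψ : AddChar F k}
    (hψ : ψ ≠ 1) (hA : ∀ g ∈ A, (conjMap P (g : Matrix _ _ F)).IsDiag)
    (hcard : Nat.card A = Fintype.card F ^ 2 + 1) {s : Sp4 F} (hs : s ∈ A)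
    (hs2 : (s : Matrix (Fin 2 ⊕ Fin 2) (Fin 2 ⊕ Fin 2) F) ^ 2 ≠ 1) {t : OE F E} {u : E}
    (hu : u * conjE F E u = 1) (ht : ∀ x, (t : E ≃ₗ[F] E) x = u * x) :
    eta hF hE hψ (tensorHom (s, t)) = 1 := by
  obtain ⟨τ, a, b, hτ, ha, hb, hq⟩ := exists_root_add_inv E hE hA hcard hs hs2
  let L := Matrix.toLinAlgEquiv' (R := F) (n := Fin 2 ⊕ Fin 2)
  set X : Module.End F (V F) := L (s.1 + (s⁻¹ : Sp4 F).1) with hXdef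
  have hss : L s.1 * L (s⁻¹ : Sp4 F).1 = 1 := by
    rw [← map_mul, ← Submonoid.coe_mul, mul_inv_cancel, Submonoid.coe_one, map_one]
  have hss' : L (s⁻¹ : Sp4 F).1 * L s.1 = 1 := by
    rw [← map_mul, ← Submonoid.coe_mul, inv_mul_cancel, Submonoid.coe_one, map_one]
  have hq' : X * X - a • X + b • 1 = 0 := by
    have := congrArg L hq
    rw [map_add, map_sub, map_mul, map_smul, map_smul, map_one, map_zero] at this
    exact this
  have hX : ∀ v w, formV F (X v) w = formV F v (X w) := by
    have h1 : ∀ v w, formV F (L s.1 v) w = formV F v (L (s⁻¹ : Sp4 F).1 w) := fun v w => by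
      have := formV_spLin s v (L (s⁻¹ : Sp4 F).1 w)
      rw [← this]
      exact congrArg (formV F (L s.1 v)) (LinearMap.congr_fun hss w).symm
    have h2 : ∀ v w, formV F (L (s⁻¹ : Sp4 F).1 v) w = formV F v (L s.1 w) := fun v w => by
      have := formV_spLin s⁻¹ v (L s.1 w)
      rw [← this]
      exact congrArg (formV F (L (s⁻¹ : Sp4 F).1 v)) (LinearMap.congr_fun hss' w).symm
    intro v w
    rw [hXdef, map_add]
    simp only [LinearMap.add_apply, map_add, h1, h2]
    rw [add_comm]
  have hpol := polarization_eigVE hF hE hX hτ ha hb hq'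
  have hact : ∀ x, (tensorHom (s, t) : V F ⊗[F] E ≃ₗ[F] V F ⊗[F] E) x
      = actV E (L s.1) (mulE F u x) := by
    intro x
    have : ((tensorHom (s, t) : V F ⊗[F] E ≃ₗ[F] V F ⊗[F] E) : V F ⊗[F] E →ₗ[F] V F ⊗[F] E)
        = actV E (L s.1) * mulE F u := by
      refine TensorProduct.ext' fun v e => ?_
      change spLin s v ⊗ₜ (t : E ≃ₗ[F] E) e = _
      rw [ht]
      rfl
    exact LinearMap.congr_fun this x
  have hcL : ∀ n, Commute (L (s.1 ^ n)) X := fun n => by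
    rw [map_pow, hXdef, map_add]
    refine Commute.pow_left ((Commute.refl _).add_right ?_) n
    rw [Commute, SemiconjBy, hss, hss']
  have hstab : ∀ n (z σ : E), ∀ x ∈ eigVE X σ, actV E (L (s.1 ^ n)) (mulE F z x) ∈ eigVE X σ :=
    fun n z σ x hx => mem_eigVE_of_commute ((hcL n).map (actV E)) (actV_comm _ _)
      (mem_eigVE_of_commute (actV_comm _ _).symm (mulE_comm _ _) hx)
  obtain ⟨m, ⟨r, hr⟩, hm⟩ := exists_two_mul_odd hF
  -- `s` is `± 1` times the square of a power of `s`
  obtain ⟨ε, hε, hsε⟩ : ∃ ε : F, ε * ε = 1 ∧ s.1 ^ m = ε • 1 := by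
    rcases pow_eq_one_or_neg_one hA hcard hm hs hs2 with h | h
    · exact ⟨1, by ring, by rw [one_smul]; exact h⟩
    · exact ⟨-1, by ring, by rw [neg_one_smul]; exact h⟩
  obtain ⟨w, hw⟩ := exists_sq_eq hF hE (y := algebraMap F E ε * u) (by
    rw [map_mul, AlgEquiv.commutes]
    have := congrArg (algebraMap F E) hε
    rw [map_mul, map_one] at this
    linear_combination (u * conjE F E u) * this + hu)
  rw [eta, weilVE, character_weilRep_of_stable _ hF hψ hpol (fun x hx => ?_)
    (actV E (L (s.1 ^ (r + 1))) * mulE F w) (fun x hx => hstab _ _ _ x hx) (fun x _ => ?_)]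
  · have : Nat.card {x : V F ⊗[F] E // x ∈ eigVE X (conjE F E τ) ∧
        (tensorHom (s, t) : V F ⊗[F] E ≃ₗ[F] V F ⊗[F] E) x = x} = 1 := by
      rw [Nat.card_eq_one_iff_unique]
      refine ⟨⟨fun x y => ?_⟩, ⟨0, zero_mem _, map_zero _⟩⟩
      have h0 : ∀ x : {x : V F ⊗[F] E // x ∈ eigVE X (conjE F E τ) ∧
          (tensorHom (s, t) : V F ⊗[F] E ≃ₗ[F] V F ⊗[F] E) x = x}, x.1 = 0 := by
        rintro ⟨x, hx, hfix⟩
        change x = 0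
        rw [hact] at hfix
        -- a fixed vector satisfies `s x = u⁻¹ x` and `s⁻¹ x = u x`
        have e1 : actV E (L (s⁻¹ : Sp4 F).1) x = mulE F u x := by
          have := congrArg (actV E (L (s⁻¹ : Sp4 F).1)) hfix
          rw [← Module.End.mul_apply (actV E (L (s⁻¹ : Sp4 F).1)), ← map_mul, hss', map_one,
            Module.End.one_apply] at this
          exact this.symm
        have e2 : actV E (L s.1) x = mulE F (conjE F E u) x := by
          have h3 := congrArg (mulE F (conjE F E u)) hfix
          rw [← Module.End.mul_apply, ← (actV_comm (L s.1) (conjE F E u)).eq, Module.End.mul_apply,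
            ← Module.End.mul_apply (mulE F (conjE F E u)), ← map_mul, mul_comm, hu, map_one,
            Module.End.one_apply] at h3
          exact h3
        rw [mem_eigVE, hXdef, map_add, map_add, LinearMap.add_apply, e1, e2, ← LinearMap.add_apply,
          ← map_add] at hx
        refine mulE_injective (z := conjE F E u + u - conjE F E τ) (fun h4 => hτ ?_) (by
          rw [map_sub, LinearMap.sub_apply, hx, sub_self])
        have h5 := congrArg (conjE F E) (sub_eq_zero.1 h4)
        rw [map_add, conjE_conjE F E hE, conjE_conjE F E hE, add_comm, sub_eq_zero.1 h4] at h5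
        exact h5
      exact Subtype.ext ((h0 x).trans (h0 y).symm)
    rw [this, Nat.cast_one]
  · rw [hact]
    have := hstab 1 u τ x hx
    rwa [pow_one] at this
  · have h1 : (actV E (L (s.1 ^ (r + 1))) * mulE F w) * (actV E (L (s.1 ^ (r + 1))) * mulE F w)
        = actV E (L s.1) * mulE F u := by
      rw [mul_assoc, ← mul_assoc (mulE F w), ← (actV_comm _ w).eq, mul_assoc, ← mul_assoc, ← map_mul,
        ← map_mul, ← map_mul, hw, ← pow_add, show r + 1 + (r + 1) = m + 1 by omega, pow_succ, hsε,
        smul_mul_assoc, one_mul, map_smul, actV_smul, map_mul, mulE_algebraMap, smul_mul_assoc,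
        smul_mul_assoc, mul_smul_comm, smul_smul, hε, one_smul, one_mul]
    rw [hact]
    exact LinearMap.congr_fun h1 x

end Rotation

/-! ### The character at `s ⊗ t` with `t` a reflection -/

section Reflection

variable {F E : Type*} [Field F] [Fintype F] [Field E] [Algebra F E] [FiniteDimensional F E]

theorem formV_skew (v w : V F) : formV F v w = -formV F w v := by
  rw [formV_apply, formV_apply]
  simp only [Fin.sum_univ_two]
  ring

theorem spLin_one (v : V F) : spLin (1 : Sp4 F) v = v := by
  rw [spLin_apply, Submonoid.coe_one, Matrix.one_mulVec]

theorem tensorHom_one_tmul (t : OE F E) (v : V F) (e : E) :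
    (tensorHom (1, t) : V F ⊗[F] E ≃ₗ[F] V F ⊗[F] E) (v ⊗ₜ e) = v ⊗ₜ (t : E ≃ₗ[F] E) e := by
  change spLin (1 : Sp4 F) v ⊗ₜ (t : E ≃ₗ[F] E) e = _
  rw [spLin_one]

section exponentialSum

variable {K : Type*} [Field K] [Algebra F K] {A : Subgroup (Sp4 F)} {P : GL (Fin 2 ⊕ Fin 2) K}
  {k : Type*} [Field k] [CharZero k]

/-- The quadratic form `w ↦ ⟨w, s w⟩` is nondegenerate and preserved by `A`, which acts freely on
the nonzero vectors. -/
theorem sum_addChar_formV (hF : ringChar F ≠ 2) {ψ : AddChar F k} (hψ : ψ ≠ 1)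
    (hA : ∀ g ∈ A, (conjMap P (g : Matrix _ _ F)).IsDiag)
    (hcard : Nat.card A = Fintype.card F ^ 2 + 1) {s : Sp4 F} (hs : s ∈ A)
    (hs2 : (s : Matrix (Fin 2 ⊕ Fin 2) (Fin 2 ⊕ Fin 2) F) ^ 2 ≠ 1) {c : F} (hc : c ≠ 0) :
    ∑ w : V F, ψ (c * formV F w (spLin s w)) = -((Fintype.card F ^ 2 : ℕ) : k) := by
  classical
  have h2 : (2 : F) ≠ 0 := Ring.two_ne_zero hF
  let : Invertible (2 : F) := invertibleOfNonzero h2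
  let β : LinearMap.BilinForm F (V F) := c • (formV F).compl₂ (spLin s : V F →ₗ[F] V F)
  have hβ : ∀ v w, β v w = c * formV F v (spLin s w) := fun v w => rfl
  have hsep : LinearMap.SeparatingLeft
      (QuadraticMap.associated (R := F) (LinearMap.BilinMap.toQuadraticMap β)) := by
    intro v hv
    by_contra hv0
    -- a vector `v` in the radical satisfies `s⁻¹ v = s v`, so it is fixed by `s²`
    have h3 : spLin s⁻¹ v - spLin s v = 0 := formV_nondeg F _ fun w => by
      have h4 : QuadraticMap.polar (LinearMap.BilinMap.toQuadraticMap β) v w = 0 := by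
        rw [← QuadraticMap.polarBilin_apply_apply, ← QuadraticMap.two_nsmul_associated F,
          LinearMap.smul_apply, LinearMap.smul_apply, hv w, smul_zero]
      rw [LinearMap.BilinMap.polar_toQuadraticMap, hβ, hβ] at h4
      have h5 : formV F v (spLin s w) = formV F (spLin s⁻¹ v) w := by
        rw [← formV_spLin s (spLin s⁻¹ v) w]
        congr 2
        rw [spLin_apply, spLin_apply, Matrix.mulVec_mulVec, ← Submonoid.coe_mul, mul_inv_cancel,
          Submonoid.coe_one, Matrix.one_mulVec]
      rw [h5, formV_skew w] at h4
      rw [map_sub, LinearMap.sub_apply]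
      have h6 : c * (formV F (spLin s⁻¹ v) w - formV F (spLin s v) w) = 0 := by
        linear_combination h4
      exact (mul_eq_zero.1 h6).resolve_left hc
    have h4 : (s * s : Sp4 F).1.mulVec v = v := by
      have := congrArg (spLin s) (sub_eq_zero.1 h3)
      rw [spLin_apply, spLin_apply, spLin_apply, spLin_apply, Matrix.mulVec_mulVec,
        Matrix.mulVec_mulVec, ← Submonoid.coe_mul, mul_inv_cancel, Submonoid.coe_one,
        Matrix.one_mulVec] at this
      rw [Submonoid.coe_mul, ← this]
    have h5 := eq_one_of_mulVec_eq hF hA hcard (A.mul_mem hs hs) h4 hv0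
    apply hs2
    rw [sq, ← Submonoid.coe_mul, h5, Submonoid.coe_one]
  have hsq := sum_addChar_quadraticForm_sq hF hψ _ hsep
  let : DistribMulAction A (V F) :=
    { smul := fun a v => spLin a.1 v
      one_smul := fun v => by
        change spLin (1 : Sp4 F) v = v
        rw [spLin_apply, Submonoid.coe_one, Matrix.one_mulVec]
      mul_smul := fun a b v => by
        change spLin (a.1 * b.1) v = spLin a.1 (spLin b.1 v)
        rw [spLin_apply, spLin_apply, spLin_apply, Submonoid.coe_mul, Matrix.mulVec_mulVec]
      smul_zero := fun a => map_zero _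
      smul_add := fun a => map_add _ }
  have hcommute : ∀ g ∈ A, ∀ v, spLin s (spLin g v) = spLin g (spLin s v) := fun g hg v => by
    rw [spLin_apply, spLin_apply, spLin_apply, spLin_apply, Matrix.mulVec_mulVec,
      Matrix.mulVec_mulVec, (commute_of_isDiag hA hs hg).eq]
  refine sum_addChar_eq_neg_of_free (A := A) ψ (fun w => c * formV F w (spLin s w)) (by simp)
    (fun a w => ?_) (fun a w haw hw => ?_) ?_ hcard ?_
  · change c * formV F (spLin a.1 w) (spLin s (spLin a.1 w)) = _
    rw [hcommute _ a.2, formV_spLin]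
  · have h3 : spLin a.1 w = w := haw
    rw [spLin_apply] at h3
    exact Subtype.ext (eq_one_of_mulVec_eq hF hA hcard a.2 h3 hw)
  · have := Fintype.one_lt_card (α := F)
    nlinarith
  · have h3 : ((quadraticChar F (-1) : ℤ) : k) ^ 2 = 1 := by
      exact_mod_cast congrArg (Int.cast : ℤ → k)
        (quadraticChar_sq_one (F := F) (neg_ne_zero.2 one_ne_zero))
    have h4 : Module.finrank F (V F) = 4 := by simp
    have e : ∀ χ q : k, χ ^ 2 = 1 → (χ * q) ^ 4 = (q ^ 2) ^ 2 := fun χ q h => by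
      have : (χ * q) ^ 4 = (χ ^ 2) ^ 2 * q ^ 4 := by ring
      rw [this, h]; ring
    rw [h4, e _ _ h3] at hsq
    rw [Nat.cast_pow, ← hsq]
    rfl

end exponentialSum

theorem map_mem_range_rTensor {L : Submodule F (V F)} {X : Module.End F (V F)}
    (hX : ∀ v ∈ L, X v ∈ L) (Y : Module.End F E) {x : V F ⊗[F] E}
    (hx : x ∈ LinearMap.range (L.subtype.rTensor E)) :
    TensorProduct.map X Y x ∈ LinearMap.range (L.subtype.rTensor E) := by
  obtain ⟨y, rfl⟩ := hx
  induction y with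
  | zero => simp
  | add a b ha hb => rw [map_add, map_add]; exact add_mem ha hb
  | tmul v e => exact ⟨(⟨X v, hX v v.2⟩ : L) ⊗ₜ Y e, rfl⟩

variable (F) in
/-- A complex structure on `V` preserving the two Lagrangians. -/
def complexV : Module.End F (V F) :=
  LinearMap.pi (Sum.elim
    ![-LinearMap.proj (Sum.inl 1), LinearMap.proj (Sum.inl 0)]
    ![-LinearMap.proj (Sum.inr 1), LinearMap.proj (Sum.inr 0)])

theorem complexV_complexV (v : V F) : complexV F (complexV F v) = -v := by
  funext i
  rcases i with i | i <;> fin_cases i <;> simp [complexV]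

theorem complexV_mem {v : V F} (hv : v ∈ lagL' F) : complexV F v ∈ lagL' F := by
  intro i
  have h : ∀ i, v (Sum.inl i) = 0 := hv
  fin_cases i <;> simp [complexV, h]

variable {k : Type*} [Field k] [CharZero k]

section

variable {t : OE F E} (b : Module.Basis (Fin 2) F E)

theorem exists_tmul_add_tmul (x : V F ⊗[F] E) : ∃ v w : V F, x = v ⊗ₜ b 0 + w ⊗ₜ b 1 := by
  induction x with
  | zero => exact ⟨0, 0, by simp⟩
  | add x y hx hy =>
    obtain ⟨v, w, rfl⟩ := hx
    obtain ⟨v', w', rfl⟩ := hy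
    exact ⟨v + v', w + w', by rw [TensorProduct.add_tmul, TensorProduct.add_tmul]; abel⟩
  | tmul v e =>
    refine ⟨b.coord 0 e • v, b.coord 1 e • v, ?_⟩
    rw [TensorProduct.smul_tmul, TensorProduct.smul_tmul, ← TensorProduct.tmul_add]
    congr 1
    conv_lhs => rw [← b.sum_repr e, Fin.sum_univ_two]
    rfl

theorem tmul_basis_injective (i : Fin 2) : Function.Injective (fun v : V F => v ⊗ₜ[F] b i) := by
  intro v w h
  have := congrArg (fun x => TensorProduct.rid F (V F) ((b.coord i).lTensor (V F) x)) h
  simpa using this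

/-- On `V ⊗ E` the element `1 ⊗ t` stabilizes the standard polarization, and is a square of an
operator preserving `L' ⊗ E`; its fixed points there are the `v ⊗ b₀` with `v` in `L'`. -/
theorem eta_one_reflection (hF : ringChar F ≠ 2) (hE : Module.finrank F E = 2) {ψ : AddChar F k}
    (hψ : ψ ≠ 1) (h0 : (t : E ≃ₗ[F] E) (b 0) = b 0) (h1 : (t : E ≃ₗ[F] E) (b 1) = -b 1) :
    eta hF hE hψ (tensorHom (1, t)) = ((Fintype.card F ^ 2 : ℕ) : k) := by
  have h2 : (2 : F) ≠ 0 := Ring.two_ne_zero hF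
  let p : Fin 2 → Module.End F E := fun i => (b.coord i).smulRight (b i)
  have hp : ∀ i e, p i e = b.coord i e • b i := fun i e => rfl
  let T : Module.End F (V F ⊗[F] E) :=
    TensorProduct.map LinearMap.id (p 0) + TensorProduct.map (complexV F) (p 1)
  have hTT : ∀ x, T (T x) = (tensorHom (1, t) : V F ⊗[F] E ≃ₗ[F] V F ⊗[F] E) x := by
    intro x
    obtain ⟨v, w, rfl⟩ := exists_tmul_add_tmul b x
    have e0 : ∀ v, T (v ⊗ₜ b 0) = v ⊗ₜ b 0 := fun v => by simp [T, hp]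
    have e1 : ∀ v, T (v ⊗ₜ b 1) = complexV F v ⊗ₜ b 1 := fun v => by simp [T, hp]
    rw [map_add, map_add, map_add, e0, e0, e1, e1, complexV_complexV, tensorHom_one_tmul,
      tensorHom_one_tmul, h0, h1,
      TensorProduct.neg_tmul, TensorProduct.tmul_neg]
  have hM : ∀ x ∈ lagLE F E, (tensorHom (1, t) : V F ⊗[F] E ≃ₗ[F] V F ⊗[F] E) x ∈ lagLE F E :=
    fun x hx => map_mem_range_rTensor (X := (spLin (1 : Sp4 F) : V F →ₗ[F] V F)) (fun v hv => by
      change spLin (1 : Sp4 F) v ∈ _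
      rwa [spLin_one]) ((t : E ≃ₗ[F] E) : E →ₗ[F] E) hx
  have hT : ∀ x ∈ lagLE' F E, T x ∈ lagLE' F E := fun x hx =>
    add_mem (map_mem_range_rTensor (X := LinearMap.id) (fun v hv => hv) _ hx)
      (map_mem_range_rTensor (fun v hv => complexV_mem hv) _ hx)
  rw [eta, weilVE, Representation.character,
    trace_weilRep_of_stable _ hF hψ hM T hT (fun x _ => hTT x)]
  congr 1
  let f : (Fin 2 → F) → {x : V F ⊗[F] E // x ∈ lagLE' F E ∧
      (tensorHom (1, t) : V F ⊗[F] E ≃ₗ[F] V F ⊗[F] E) x = x} := fun z =>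
    ⟨(Sum.elim (0 : Fin 2 → F) z : V F) ⊗ₜ b 0,
      ⟨(⟨Sum.elim (0 : Fin 2 → F) z, fun i => rfl⟩ : lagL' F) ⊗ₜ b 0, rfl⟩, by
      rw [tensorHom_one_tmul, h0]⟩
  have hf : Function.Bijective f := by
    constructor
    · intro z z' h
      have h3 : (Sum.elim (0 : Fin 2 → F) z : V F) = Sum.elim (0 : Fin 2 → F) z' :=
        tmul_basis_injective b 0 (congrArg Subtype.val h)
      funext i
      exact congrFun h3 (Sum.inr i)
    · rintro ⟨x, hx, hfix⟩
      obtain ⟨v, w, rfl⟩ := exists_tmul_add_tmul b x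
      rw [map_add, tensorHom_one_tmul, tensorHom_one_tmul, h0, h1, TensorProduct.tmul_neg] at hfix
      have hw : w = 0 := by
        have h3 : ((2 : F) • w) ⊗ₜ[F] b 1 = (0 : V F) ⊗ₜ b 1 := by
          rw [two_smul, TensorProduct.add_tmul, TensorProduct.zero_tmul]
          nth_rw 1 [← neg_eq_iff_add_eq_zero]
          exact add_left_cancel hfix
        exact (smul_eq_zero.1 (tmul_basis_injective b 1 h3)).resolve_left h2
      subst hw
      rw [TensorProduct.zero_tmul, add_zero] at hx
      obtain ⟨y, hy⟩ := hx
      have hv : ∀ i, v (Sum.inl i) = 0 := fun i => by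
        have key : ∀ y : lagL' F ⊗[F] E, TensorProduct.rid F (V F)
            ((b.coord 0).lTensor (V F) ((lagL' F).subtype.rTensor E y)) (Sum.inl i) = 0 := by
          intro y
          induction y with
          | zero => simp
          | add y z hy hz => simp only [map_add, Pi.add_apply, hy, hz, add_zero]
          | tmul v e =>
            have h4 : ∀ i, (v : V F) (Sum.inl i) = 0 := v.2
            simp [h4]
        have h3 := key y
        rw [hy] at h3
        simpa using h3
      refine ⟨fun i => v (Sum.inr i), Subtype.ext ?_⟩
      change (Sum.elim (0 : Fin 2 → F) (fun i => v (Sum.inr i)) : V F) ⊗ₜ[F] b 0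
        = v ⊗ₜ b 0 + 0 ⊗ₜ b 1
      rw [TensorProduct.zero_tmul, add_zero]
      congr 1
      funext i
      rcases i with i | i
      · exact (hv i).symm
      · rfl
  rw [← Nat.card_congr (Equiv.ofBijective f hf)]
  simp

end

end Reflection

section Reflection

variable {F E : Type*} [Field F] [Fintype F] [Field E] [Algebra F E] [FiniteDimensional F E]
  {K : Type*} [Field K] [IsAlgClosed K] [Algebra F K] {A : Subgroup (Sp4 F)}
  {P : GL (Fin 2 ⊕ Fin 2) K} {k : Type*} [Field k] [CharZero k]

/-- The operators of the Heisenberg group attached to the eigenspace `V ⊗ b₁` of `1 ⊗ t` for `-1`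
sum to an operator that implements the reflection `1 ⊗ t`. -/
theorem twines_reflection (hF : ringChar F ≠ 2) (hE : Module.finrank F E = 2) (ψ : AddChar F k)
    {t : OE F E} (b : Module.Basis (Fin 2) F E) (h0 : (t : E ≃ₗ[F] E) (b 0) = b 0)
    (h1 : (t : E ≃ₗ[F] E) (b 1) = -b 1) :
    Twines (polarization F E hF hE) ψ (tensorHom (1, t) : V F ⊗[F] E ≃ₗ[F] V F ⊗[F] E)
      (∑ w : V F, heisenbergOp (polarization F E hF hE) ψ (w ⊗ₜ b 1)) := by
  have h2 : (2 : F) ≠ 0 := Ring.two_ne_zero hF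
  intro u
  obtain ⟨v, z, rfl⟩ := exists_tmul_add_tmul b u
  have horth : formE F E (b 0) (b 1) = 0 := by
    have h3 := t.2 (b 0) (b 1)
    rw [h0, h1, map_neg] at h3
    have h4 : 2 * formE F E (b 0) (b 1) = 0 := by linear_combination -h3
    exact (mul_eq_zero.1 h4).resolve_left h2
  have horth' : formE F E (b 1) (b 0) = 0 := by rw [formE_symm F E hE, horth]
  have hself : ∀ v, formV F v v = 0 := fun v => by
    rw [formV_apply]
    simp only [Fin.sum_univ_two]
    ring
  rw [Finset.sum_mul, Finset.mul_sum, ← Equiv.sum_comp (Equiv.addRight (z + z)) (fun w =>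
    heisenbergOp (polarization F E hF hE) ψ _ * heisenbergOp (polarization F E hF hE) ψ (w ⊗ₜ b 1))]
  refine Finset.sum_congr rfl fun w _ => ?_
  have hg : (tensorHom (1, t) : V F ⊗[F] E ≃ₗ[F] V F ⊗[F] E) (v ⊗ₜ b 0 + z ⊗ₜ b 1)
      = v ⊗ₜ b 0 + z ⊗ₜ (-b 1) := by rw [map_add, tensorHom_one_tmul, tensorHom_one_tmul, h0, h1]
  rw [heis_mul _ h2, heis_mul _ h2, hg]
  congr 2
  · congr 1
    simp only [Equiv.coe_addRight, map_add, LinearMap.add_apply, formVE_tmul, TensorProduct.tmul_neg,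
      TensorProduct.add_tmul, map_neg, LinearMap.neg_apply, horth, horth', hself, formV_skew z w]
    ring
  · simp only [Equiv.coe_addRight, TensorProduct.add_tmul, TensorProduct.tmul_neg]
    abel

theorem card_lagLE' (hF : ringChar F ≠ 2) (hE : Module.finrank F E = 2) :
    Nat.card (lagLE' F E) = Fintype.card F ^ 4 := by
  have h := polarization F E hF hE
  have := Module.finite_of_finite F (M := V F ⊗[F] E)
  have e1 := Submodule.finrank_add_eq_of_isCompl h.isCompl
  rw [finrank_eq_of_polarization h, Module.finrank_tensorProduct, hE] at e1
  have h4 : Module.finrank F (V F) = 4 := by simp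
  have := Fintype.ofFinite (lagLE' F E)
  rw [Nat.card_eq_fintype_card, Module.card_eq_pow_finrank (K := F)]
  congr 1
  omega

/-- `ω (s ⊗ t) = ω (s ⊗ 1) ω (1 ⊗ t)`, and the trace of the product is, up to a power of `q`, the
exponential sum of the quadratic form `⟨w, s w⟩` on `V`. -/
theorem eta_eq_neg_one (hF : ringChar F ≠ 2) (hE : Module.finrank F E = 2) {ψ : AddChar F k}
    (hψ : ψ ≠ 1) (hA : ∀ g ∈ A, (conjMap P (g : Matrix _ _ F)).IsDiag)
    (hcard : Nat.card A = Fintype.card F ^ 2 + 1) {s : Sp4 F} (hs : s ∈ A)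
    (hs2 : (s : Matrix (Fin 2 ⊕ Fin 2) (Fin 2 ⊕ Fin 2) F) ^ 2 ≠ 1) {t : OE F E}
    (b : Module.Basis (Fin 2) F E) (h0 : (t : E ≃ₗ[F] E) (b 0) = b 0)
    (h1 : (t : E ≃ₗ[F] E) (b 1) = -b 1) :
    eta hF hE hψ (tensorHom (s, t)) = -1 := by
  classical
  have h2 : (2 : F) ≠ 0 := Ring.two_ne_zero hF
  set h := polarization F E hF hE with hh
  set q : k := ((Fintype.card F : ℕ) : k) with hq
  have hq0 : q ≠ 0 := Nat.cast_ne_zero.2 Fintype.card_ne_zero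
  have hc : formE F E (b 1) (b 1) ≠ 0 := by
    intro hc
    have horth : formE F E (b 1) (b 0) = 0 := by
      have h3 := t.2 (b 1) (b 0)
      rw [h0, h1, map_neg, LinearMap.neg_apply] at h3
      have h4 : 2 * formE F E (b 1) (b 0) = 0 := by linear_combination -h3
      exact (mul_eq_zero.1 h4).resolve_left h2
    refine b.ne_zero 1 (formE_nondeg F E hF _ fun y => ?_)
    rw [← b.sum_repr y, map_sum, Fin.sum_univ_two, map_smul, map_smul, hc, horth, smul_zero,
      smul_zero, add_zero]
  set R : Module.End k (lagLE' F E → k) := ∑ w : V F, heisenbergOp h ψ (w ⊗ₜ b 1) with hR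
  have htrR : LinearMap.trace k _ R = q ^ 4 := by
    have := Fintype.ofFinite (lagLE' F E)
    rw [hR, map_sum, Finset.sum_eq_single 0, TensorProduct.zero_tmul, heis_zero,
      LinearMap.trace_one, Module.finrank_fintype_fun_eq_card, ← Nat.card_eq_fintype_card,
      card_lagLE' hF hE, Nat.cast_pow]
    · intro w _ hw
      refine trace_heis h hψ _ fun h3 => hw (tmul_basis_injective b 1 ?_)
      simpa using h3
    · simp
  have hωt : weilRep h hF hψ (tensorHom (1, t)) = (q ^ 2)⁻¹ • R := by
    have h3 : LinearMap.trace k _ (weilRep h hF hψ (tensorHom (1, t))) = q ^ 2 := by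
      have := eta_one_reflection b hF hE hψ h0 h1
      rw [Nat.cast_pow] at this
      exact this
    rw [weilRep_eq_smul_of_twines h hF hψ (twines_reflection hF hE ψ b h0 h1)
      (by rw [← hR, htrR]; exact pow_ne_zero _ hq0), ← hR, htrR, h3]
    congr 1
    field_simp
  have hωs : (weilRep h hF hψ).character (tensorHom (s, (1 : OE F E))) = 1 :=
    eta_eq_one hF hE hψ hA hcard hs hs2 (u := 1) (by simp) (fun x => by simp)
  -- `s - 1` is bijective on `V`, so the sum over `V` may be taken over the vectors `s w - w`
  have hsub : Function.Bijective (fun w : V F => spLin s w - w) := by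
    refine Finite.injective_iff_bijective.1 fun w w' h3 => ?_
    by_contra hne
    have h4 : spLin s (w - w') = w - w' := by
      rw [map_sub]
      have h5 : spLin s w - w = spLin s w' - w' := h3
      rw [sub_eq_sub_iff_sub_eq_sub, h5]
    rw [spLin_apply] at h4
    have h5 := eq_one_of_mulVec_eq hF hA hcard hs h4 (sub_ne_zero.2 hne)
    apply hs2
    rw [h5, Submonoid.coe_one, one_pow]
  have hact : ∀ w : V F, (tensorHom (s, (1 : OE F E)) : V F ⊗[F] E ≃ₗ[F] V F ⊗[F] E) (w ⊗ₜ b 1)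
      = spLin s w ⊗ₜ b 1 := fun w => rfl
  have hterm : ∀ w : V F, LinearMap.trace k _ (heisenbergOp h ψ ((spLin s w - w) ⊗ₜ b 1)
      * weilRep h hF hψ (tensorHom (s, (1 : OE F E))))
      = ψ (2⁻¹ * formE F E (b 1) (b 1) * formV F w (spLin s w)) := fun w => by
    have h3 := trace_heis_mul_weilRep h hF hψ (tensorHom (s, (1 : OE F E))) (w ⊗ₜ b 1)
    rw [hact, ← TensorProduct.sub_tmul, hωs, mul_one, formVE_tmul] at h3
    rw [h3]
    congr 1
    ring
  have hprod : tensorHom (s, t) = tensorHom (s, (1 : OE F E)) * tensorHom (1, t) := by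
    rw [← map_mul, Prod.mk_mul_mk, mul_one, one_mul]
  rw [eta, weilVE, Representation.character, hprod, map_mul, LinearMap.trace_mul_comm, hωt,
    smul_mul_assoc, map_smul, hR, Finset.sum_mul, map_sum,
    ← (Equiv.ofBijective _ hsub).sum_comp, smul_eq_mul]
  simp only [Equiv.ofBijective_apply, hterm]
  rw [sum_addChar_formV hF hψ hA hcard hs hs2 (mul_ne_zero (inv_ne_zero h2) hc), Nat.cast_pow, ← hq]
  field_simp

end Reflection

/-! ### The character `θ₁₀` -/

section Theta

variable {F E : Type*} [Field F] [Fintype F] [Field E] [Algebra F E] [FiniteDimensional F E]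
  {k : Type*} [Field k] [CharZero k]

open Classical in
/-- The character of `O(E)` with kernel `SO(E)`. -/
noncomputable def signO (k : Type*) [Field k] (t : OE F E) : k :=
  if LinearMap.det ((t : E ≃ₗ[F] E) : E →ₗ[F] E) = 1 then 1 else -1

theorem signO_mul_self (t : OE F E) : signO k t * signO k t = 1 := by
  rw [signO]; split_ifs <;> ring

theorem det_eq_one_or (hF : ringChar F ≠ 2) (t : OE F E) :
    LinearMap.det ((t : E ≃ₗ[F] E) : E →ₗ[F] E) = 1 ∨
      LinearMap.det ((t : E ≃ₗ[F] E) : E →ₗ[F] E) = -1 :=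
  mul_self_eq_one_iff.1 (by
    rw [← sq]; exact det_sq_eq_one_of_isometry (formE_nondeg F E hF) t.2)

theorem det_mul_coe (t t' : OE F E) :
    LinearMap.det (((t * t' : OE F E) : E ≃ₗ[F] E) : E →ₗ[F] E)
      = LinearMap.det ((t : E ≃ₗ[F] E) : E →ₗ[F] E)
        * LinearMap.det ((t' : E ≃ₗ[F] E) : E →ₗ[F] E) := by
  rw [← map_mul]; rfl

theorem signO_mul (hF : ringChar F ≠ 2) (t t' : OE F E) :
    signO k (t * t') = signO k t * signO k t' := by
  have hne : (-1 : F) ≠ 1 := Ring.neg_one_ne_one_of_char_ne_two hF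
  rw [signO, signO, signO, det_mul_coe]
  rcases det_eq_one_or hF t with h | h <;> rcases det_eq_one_or hF t' with h' | h' <;>
    simp [h, h', hne]

theorem det_sigmaE (hF : ringChar F ≠ 2) (hE : Module.finrank F E = 2) :
    LinearMap.det ((sigmaE F E : E ≃ₗ[F] E) : E →ₗ[F] E) ≠ 1 := by
  obtain ⟨b, h0, h1⟩ := exists_basis_reflection hF hE (t := (sigmaE F E : E ≃ₗ[F] E)) (u := 1)
    (by simp) (fun x => by rw [one_mul]; rfl)
  rw [det_reflection b h0 h1]
  exact Ring.neg_one_ne_one_of_char_ne_two hF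

theorem mem_W1minus_iff (hF : ringChar F ≠ 2) (hE : Module.finrank F E = 2) {ψ : AddChar F k}
    (hψ : ψ ≠ 1) (f : lagLE' F E → k) : f ∈ (W1minus hF hE hψ).toSubmodule ↔
      ∀ t : OE F E, weilVE hF hE hψ (tensorHom (1, t)) f = signO k t • f := by
  constructor
  · rintro ⟨hf, hσ⟩ t
    rw [signO]
    split_ifs with ht
    · rw [one_smul, hf t ht]
    · have h1 : LinearMap.det (((t * (sigmaE F E)⁻¹ : OE F E) : E ≃ₗ[F] E) : E →ₗ[F] E) = 1 := by
        have h3 := det_mul_coe (t * (sigmaE F E)⁻¹) (sigmaE F E)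
        rw [inv_mul_cancel_right, (det_eq_one_or hF t).resolve_left ht,
          (det_eq_one_or hF (sigmaE F E)).resolve_left (det_sigmaE hF hE)] at h3
        linear_combination h3
      have h2 : tensorHom (1, t) = tensorHom ((1 : Sp4 F), t * (sigmaE F E)⁻¹)
          * tensorHom (1, sigmaE F E) := by
        rw [← map_mul, Prod.mk_mul_mk, mul_one, inv_mul_cancel_right]
      rw [h2, map_mul, Module.End.mul_apply, hσ, map_neg, hf _ h1, neg_one_smul]
  · intro h
    refine ⟨fun t ht => ?_, ?_⟩
    · rw [h t, signO, if_pos ht, one_smul]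
    · rw [h, signO, if_neg (det_sigmaE hF hE), neg_one_smul]

/-- Projecting to `W₁⁻` by averaging over `O(E)` expresses `θ₁₀` through `η`. -/
theorem theta10_eq_sum (hF : ringChar F ≠ 2) (hE : Module.finrank F E = 2) {ψ : AddChar F k}
    (hψ : ψ ≠ 1) [Fintype (OE F E)] (s : Sp4 F) :
    theta10 hF hE hψ s
      = (Fintype.card (OE F E) : k)⁻¹ * ∑ t, signO k t * eta hF hE hψ (tensorHom (s, t)) := by
  have hN : (Fintype.card (OE F E) : k) ≠ 0 := Nat.cast_ne_zero.2 Fintype.card_ne_zero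
  let ρ : OE F E → Module.End k (lagLE' F E → k) := fun t => weilVE hF hE hψ (tensorHom (1, t))
  let e : Module.End k (lagLE' F E → k) := (Fintype.card (OE F E) : k)⁻¹ • ∑ t, signO k t • ρ t
  have he_mem : ∀ f, e f ∈ (W1minus hF hE hψ).toSubmodule := fun f => by
    rw [mem_W1minus_iff]
    intro t
    simp only [e, LinearMap.smul_apply, LinearMap.sum_apply, map_smul, map_sum]
    rw [smul_comm]
    congr 1
    rw [Finset.smul_sum, ← Equiv.sum_comp (Equiv.mulLeft t)
      (fun t' => signO k t • signO k t' • ρ t' f)]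
    refine Finset.sum_congr rfl fun t' _ => ?_
    have h1 : ρ (t * t') = ρ t * ρ t' := by
      simp only [ρ]
      rw [← map_mul, ← map_mul, Prod.mk_mul_mk, mul_one]
    rw [Equiv.coe_mulLeft, signO_mul hF, h1, smul_smul, ← mul_assoc, signO_mul_self, one_mul]
    rfl
  have he_id : ∀ f ∈ (W1minus hF hE hψ).toSubmodule, e f = f := fun f hf => by
    rw [mem_W1minus_iff] at hf
    simp only [e, LinearMap.smul_apply, LinearMap.sum_apply, ρ, hf, smul_smul, signO_mul_self,
      one_smul, Finset.sum_const, Finset.card_univ]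
    rw [← Nat.cast_smul_eq_nsmul k, smul_smul, inv_mul_cancel₀ hN, one_smul]
  let e' : (lagLE' F E → k) →ₗ[k] (W1minus hF hE hψ).toSubmodule := e.codRestrict _ he_mem
  let T : Module.End k (W1minus hF hE hψ).toSubmodule := (W1minus hF hE hψ).toRepresentation s
  have h1 : theta10 hF hE hψ s = LinearMap.trace k (lagLE' F E → k) (weilV hF hE hψ s * e) := by
    have h2 : (T ∘ₗ e') ∘ₗ (W1minus hF hE hψ).toSubmodule.subtype = T := by
      refine LinearMap.ext fun f => ?_
      have : e' f = f := Subtype.ext (he_id f f.2)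
      change T (e' f) = T f
      rw [this]
    have h3 : (W1minus hF hE hψ).toSubmodule.subtype ∘ₗ (T ∘ₗ e') = weilV hF hE hψ s * e := rfl
    rw [← h3]
    refine Eq.trans ?_ (LinearMap.trace_comp_comm' (R := k) (T ∘ₗ e')
      (W1minus hF hE hψ).toSubmodule.subtype).symm
    rw [h2]
    rfl
  have h2 : ∀ t, weilV hF hE hψ s * ρ t = weilVE hF hE hψ (tensorHom (s, t)) := fun t => by
    have : tensorHom (s, t) = tensorHom (s, (1 : OE F E)) * tensorHom (1, t) := by
      rw [← map_mul, Prod.mk_mul_mk, mul_one, one_mul]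
    rw [this, map_mul]
    rfl
  have h3 : weilV hF hE hψ s * e = (Fintype.card (OE F E) : k)⁻¹ •
      ∑ t, signO k t • weilVE hF hE hψ (tensorHom (s, t)) := by
    simp only [e, mul_smul_comm, Finset.mul_sum, h2]
  rw [h1, h3, map_smul, map_sum, smul_eq_mul]
  refine congrArg _ (Finset.sum_congr rfl fun t _ => ?_)
  rw [map_smul, smul_eq_mul]
  rfl

end Theta

/-! ### Rational points of the torus and the characters of its elements -/

/-- Frobenius fixes a matrix exactly when its entries lie in `F`, so its fixed points in `T` are the
points of `T` in `Sp(4, F)`. -/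
theorem card_comap_fixedPoints {F K : Type*} [Field F] [Fintype F] [Field K] [Algebra F K]
    (T : Subgroup (Sp4 K)) :
    Nat.card ((fixedPoints F T).comap (spMap (algebraMap F K))) = Nat.card (fixedPoints F T) := by
  have hinj : Function.Injective (spMap (algebraMap F K)) := fun a b hab => Subtype.ext
    (Matrix.map_injective (algebraMap F K).injective (congrArg Subtype.val hab))
  refine Nat.card_congr (Equiv.ofBijective (fun g => ⟨spMap (algebraMap F K) g.1, g.2⟩)
    ⟨fun a b hab => Subtype.ext (hinj (congrArg Subtype.val hab)), ?_⟩)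
  rintro ⟨g, hg⟩
  have hfix : ∀ i j, g.1 i j ^ Fintype.card F = g.1 i j := fun i j => by
    rw [← coe_frob]
    have : frob F g = g := hg.2
    rw [this]
  choose m hm using fun i j => exists_map_eq_of_pow_card (algebraMap F K) (hfix i j)
  have hm' : (Matrix.of m).map (algebraMap F K) = g.1 := by ext i j; exact hm i j
  have hmem : Matrix.of m ∈ Matrix.symplecticGroup (Fin 2) F := by
    rw [SymplecticGroup.mem_iff]
    apply Matrix.map_injective (algebraMap F K).injective
    have := SymplecticGroup.mem_iff.1 g.2
    rw [← hm', ← Matrix.map_J (Fin 2) (algebraMap F K), ← Matrix.transpose_map, ← Matrix.map_mul,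
      ← Matrix.map_mul] at this
    exact this
  have hg' : spMap (algebraMap F K) ⟨_, hmem⟩ = g := Subtype.ext hm'
  exact ⟨⟨⟨_, hmem⟩, by rw [Subgroup.mem_comap, hg']; exact hg⟩, Subtype.ext hg'⟩

/-- The torus may live over any algebraically closed extension of `F`, and the characters take values
in any field of characteristic zero. -/
theorem regularSemisimple_and_characters {F E : Type*} [Field F] [Fintype F] (hF : ringChar F ≠ 2)
    [Field E] [Algebra F E] [FiniteDimensional F E] (hE : Module.finrank F E = 2)
    {K : Type*} [Field K] [IsAlgClosed K] [Algebra F K] {k : Type*} [Field k] [CharZero k]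
    {ψ : AddChar F k} (hψ : ψ ≠ 1) {T : Subgroup (Sp4 K)} (hT : IsMaximalTorus T)
    (hcard : Nat.card (fixedPoints F T) = Fintype.card F ^ 2 + 1) {s : Sp4 F}
    (hs : spMap (algebraMap F K) s ∈ fixedPoints F T)
    (hs1 : (s : Matrix (Fin 2 ⊕ Fin 2) (Fin 2 ⊕ Fin 2) F) ≠ 1)
    (hs2 : (s : Matrix (Fin 2 ⊕ Fin 2) (Fin 2 ⊕ Fin 2) F) ≠ -1) :
    IsRegularSemisimple (spMap (algebraMap F K) s) ∧ theta10 hF hE hψ s = 1 ∧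
      ∀ t : OE F E,
        (LinearMap.det ((t : E ≃ₗ[F] E) : E →ₗ[F] E) = 1 →
          eta hF hE hψ (tensorHom (s, t)) = 1) ∧
        (LinearMap.det ((t : E ≃ₗ[F] E) : E →ₗ[F] E) ≠ 1 →
          eta hF hE hψ (tensorHom (s, t)) = -1) := by
  obtain ⟨P, hP⟩ := hT.prop.diagonalizable
  let A : Subgroup (Sp4 F) := (fixedPoints F T).comap (spMap (algebraMap F K))
  have hA : ∀ g ∈ A, (conjMap P (g : Matrix _ _ F)).IsDiag := fun g hg => hP _ hg.1
  have hAcard : Nat.card A = Fintype.card F ^ 2 + 1 := by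
    rw [← hcard]; exact card_comap_fixedPoints T
  have hsA : s ∈ A := hs
  have hss := sq_ne_one hF hA hAcard hsA hs1 hs2
  have heta : ∀ t : OE F E,
      (LinearMap.det ((t : E ≃ₗ[F] E) : E →ₗ[F] E) = 1 →
        eta hF hE hψ (tensorHom (s, t)) = 1) ∧
      (LinearMap.det ((t : E ≃ₗ[F] E) : E →ₗ[F] E) ≠ 1 →
        eta hF hE hψ (tensorHom (s, t)) = -1) := by
    refine fun t => ⟨fun ht => ?_, fun ht => ?_⟩
    · obtain ⟨u, hu, htu⟩ := exists_mul_of_det_eq_one hF hE ht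
      exact eta_eq_one hF hE hψ hA hAcard hsA hss hu htu
    · obtain ⟨b, h0, h1⟩ := exists_basis_of_det_ne_one hF hE ht
      exact eta_eq_neg_one hF hE hψ hA hAcard hsA hss b h0 h1
  refine ⟨?_, ?_, heta⟩
  · obtain ⟨-, -, -, -, hinj, -⟩ := exists_eig hA hAcard hsA hss
    exact isRegularSemisimple_of_injective hT hs.1 hP (conjMap_eq_diagonal hA hsA) hinj
  · have := Module.finite_of_finite F (M := E)
    have : Finite (E ≃ₗ[F] E) := DFunLike.finite _
    have := Fintype.ofFinite (OE F E)
    rw [theta10_eq_sum]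
    have h1 : ∀ t : OE F E, signO k t * eta hF hE hψ (tensorHom (s, t)) = 1 := by
      intro t
      rw [signO]
      split_ifs with ht
      · rw [(heta t).1 ht, one_mul]
      · rw [(heta t).2 ht]; ring
    simp only [h1, Finset.sum_const, Finset.card_univ, nsmul_eq_mul, mul_one]
    exact inv_mul_cancel₀ (Nat.cast_ne_zero.2 Fintype.card_ne_zero)

end Theta10

theorem mainTheorem5 {F E : Type*} [Field F] [Fintype F] (hF : ringChar F ≠ 2)
    [Field E] [Algebra F E] [FiniteDimensional F E] (hE : Module.finrank F E = 2)
    (l : ℕ) [Fact l.Prime] (hl : l ≠ ringChar F)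
    (ψ : AddChar F (AlgebraicClosure ℚ_[l])) (hψ : ψ ≠ 1)
    (T : Subgroup (Theta10.Sp4 (AlgebraicClosure F))) (hT : Theta10.IsMaximalTorus T)
    (hTF : T.map (Theta10.frob F) ≤ T)
    (hcard : Nat.card (Theta10.fixedPoints F T) = Fintype.card F ^ 2 + 1)
    (s : Theta10.Sp4 F)
    (hs : Theta10.spMap (algebraMap F (AlgebraicClosure F)) s ∈ Theta10.fixedPoints F T)
    (hs1 : (s : Matrix (Fin 2 ⊕ Fin 2) (Fin 2 ⊕ Fin 2) F) ≠ 1)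
    (hs2 : (s : Matrix (Fin 2 ⊕ Fin 2) (Fin 2 ⊕ Fin 2) F) ≠ -1) :
    Theta10.IsRegularSemisimple (Theta10.spMap (algebraMap F (AlgebraicClosure F)) s) ∧
    Theta10.theta10 hF hE hψ s = 1 ∧
    ∀ t : Theta10.OE F E,
      (LinearMap.det ((t : E ≃ₗ[F] E) : E →ₗ[F] E) = 1 →
        Theta10.eta hF hE hψ (Theta10.tensorHom (s, t)) = 1) ∧
      (LinearMap.det ((t : E ≃ₗ[F] E) : E →ₗ[F] E) ≠ 1 →
        Theta10.eta hF hE hψ (Theta10.tensorHom (s, t)) = -1) :=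
  Theta10.regularSemisimple_and_characters hF hE hψ hT hcard hs hs1 hs2
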